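/- For a compact metrizable $\mathbb Z$-system $X$ let $P(X)$ be the space of Borel probability measures on $X$ with the weak$^*$ topology and the induced action, and let $E(X)\subset X^X$ be the enveloping semigroup, i.e. the pointwise closure of the set of translations $x\mapsto n\cdot x$ ($n\in\mathbb Z$). The system $X$ is called injective if the restriction homomorphism $r:E(P(X))\to E(X)$ (points of $X$ being identified with Dirac measures) is injective. Two points $z,z'$ of a compact system are called proximal if $\lim n_i z=\lim n_i z'$ for some net $(n_i)$ in $\mathbb Z$. Let $S$ be the shift $(Sx)(n)=x(n+1)$ on $\{0,1\}^{\mathbb Z}$ and let $Y$ be the orbit closure of the Heaviside sequence $y_0$, where $y_0(n)=0$ for $n<0$ and $y_0(n)=1$ for $n\ge 0$. For $\eta\in\{0,1\}^{\mathbb Z}$ and $q\geq 1$ let $\mathrm{Per}_q(\eta)=\{n:\eta(n+kq)=\eta(n)\ \forall k\in\mathbb Z\}$. **Theorem.** There are integers $1=p_0<p_1<p_2<\cdots$ with $p_i\mid p_{i+1}$ and a sequence $\eta\in\{0,1\}^{\mathbb Z}$ with orbit closure $X=\overline{\{S^n\eta:n\in\mathbb Z\}}$ such that: 1. $\eta$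 arises from $Y$ by Williams' construction with periods $(p_i)$. That is, for $J(i,n)=\{k\in[np_i,(n+1)p_i): k\notin\mathrm{Per}_{p_i}(\eta)\}$, each $J(i,n)$ is contained in or disjoint from $\mathrm{Per}_{p_{i+1}}(\eta)$; $J(i,0)$ and $J(i,-1)$ are contained in $\mathrm{Per}_{p_{i+1}}(\eta)$; and, for each $i$, the words read by $\eta$ along the sets $J(i,n)$, $n\in\mathbb Z$, in increasing order, are exactly the words of length $|J(i,0)|$ occurring in $Y$. 2. $\eta$ is a Toeplitz sequence (it is not periodic, and every $n\in\mathbb Z$ lies in some $\mathrm{Per}_q(\eta)$, $q\ge1$) and it is non-regular: the supremum over $q\ge 1$ of the densities of the sets $\mathrm{Per}_q(\eta)$ is less than $1$. 3. $(X,S)$ is a compact metrizable minimal system and an almost one-to-one extension of the adding machine $\varprojlim\mathbb Z/p_i\mathbb Z$: there is an equivariant continuous surjection $\pi$ of $X$ onto it such that the set of $x\in X$ with $\pi^{-1}(\pi(x))=\{x\}$ is dense in $X$. 4. There are a measure $\nu\in P(X)$ and two different ergodic $S$-invariant measures $\mu_0,\mu_1\in P(X)$ such that $S^n\nu\to\mu_0$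 as $n\to-\infty$ and $S^n\nu\to\mu_1$ as $n\to+\infty$. Hence $\nu$ is proximal to both $\mu_0$ and $\mu_1$, while $\mu_0$ and $\mu_1$ are not proximal, and so the proximal relation on $P(X)$ is not an equivalence relation. 5. The system $(X,S)$ is not injective. -/

import Mathlib

open Set Filter Topology MeasureTheory

/-! ### Compact `ℤ`-systems -/

/-- The action of `ℤ` on Borel probability measures induced by a continuous action on the space:
`n +ᵥ μ` is the push-forward of `μ` under `x ↦ n +ᵥ x`. -/
noncomputable instance probabilityMeasureAddAction {X : Type*} [TopologicalSpace X]
    [MeasurableSpace X] [BorelSpace X] [AddAction ℤ X] [ContinuousConstVAdd ℤ X] :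
    AddAction ℤ (ProbabilityMeasure X) where
  vadd n μ := μ.map (f := fun x : X => n +ᵥ x) (continuous_const_vadd n).measurable.aemeasurable
  zero_vadd μ := by
    apply Subtype.ext
    change (μ : Measure X).map (fun x : X => (0 : ℤ) +ᵥ x) = μ
    simp
  add_vadd m n μ := by
    apply Subtype.ext
    change (μ : Measure X).map (fun x : X => (m + n) +ᵥ x) =
      ((μ : Measure X).map (fun x : X => n +ᵥ x)).map (fun x : X => m +ᵥ x)
    rw [Measure.map_map (continuous_const_vadd m).measurable (continuous_const_vadd n).measurable]
    congr 1
    funext x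
    exact add_vadd m n x

theorem vadd_diracProba {X : Type*} [TopologicalSpace X]
    [MeasurableSpace X] [BorelSpace X] [AddAction ℤ X] [ContinuousConstVAdd ℤ X] (n : ℤ) (x : X) :
    n +ᵥ diracProba x = diracProba (n +ᵥ x) := by
  apply Subtype.ext
  exact Measure.map_dirac' (continuous_const_vadd n).measurable x

/-- The enveloping (Ellis) semigroup of a `ℤ`-system: the closure of the set of translations in
`Z → Z`, for the topology of pointwise convergence. -/
def envelopingSemigroup (Z : Type*) [TopologicalSpace Z] [AddAction ℤ Z] : Set (Z → Z) :=
  closure (range fun (n : ℤ) (z : Z) => n +ᵥ z)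

/-- Identifying points with Dirac measures, every element of `E(P(X))` restricts to an element of
`E(X)`. -/
theorem exists_restriction {X : Type*} [TopologicalSpace X] [CompactSpace X]
    [TopologicalSpace.MetrizableSpace X] [MeasurableSpace X] [BorelSpace X] [AddAction ℤ X]
    [ContinuousConstVAdd ℤ X] (p : envelopingSemigroup (ProbabilityMeasure X)) :
    ∃ q : envelopingSemigroup X, ∀ x, p.1 (diracProba x) = diracProba (q.1 x) := by
  have hK : IsCompact (envelopingSemigroup X) := isClosed_closure.isCompact
  have hc : Continuous fun (q : X → X) (x : X) => diracProba (q x) :=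
    continuous_pi fun x => continuous_diracProba.comp (continuous_apply x)
  have hcl : IsClosed ((fun (q : X → X) (x : X) => diracProba (q x)) '' envelopingSemigroup X) :=
    (hK.image hc).isClosed
  have hr : Continuous fun (p : ProbabilityMeasure X → ProbabilityMeasure X) (x : X) =>
      p (diracProba x) :=
    continuous_pi fun x => continuous_apply (diracProba x)
  have hsub : envelopingSemigroup (ProbabilityMeasure X) ⊆
      (fun (p : ProbabilityMeasure X → ProbabilityMeasure X) (x : X) => p (diracProba x)) ⁻¹'
        ((fun (q : X → X) (x : X) => diracProba (q x)) '' envelopingSemigroup X) := by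
    refine closure_minimal ?_ (hcl.preimage hr)
    rintro _ ⟨n, rfl⟩
    refine ⟨fun x => n +ᵥ x, subset_closure ⟨n, rfl⟩, ?_⟩
    funext x
    exact (vadd_diracProba n x).symm
  obtain ⟨q, hq, h⟩ := hsub p.2
  exact ⟨⟨q, hq⟩, fun x => (congrFun h x).symm⟩

/-- The restriction homomorphism `r : E(P(X)) → E(X)`. -/
noncomputable def restriction {X : Type*} [TopologicalSpace X] [CompactSpace X]
    [TopologicalSpace.MetrizableSpace X] [MeasurableSpace X] [BorelSpace X] [AddAction ℤ X]
    [ContinuousConstVAdd ℤ X] (p : envelopingSemigroup (ProbabilityMeasure X)) :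
    envelopingSemigroup X :=
  (exists_restriction p).choose

theorem restriction_spec {X : Type*} [TopologicalSpace X] [CompactSpace X]
    [TopologicalSpace.MetrizableSpace X] [MeasurableSpace X] [BorelSpace X] [AddAction ℤ X]
    [ContinuousConstVAdd ℤ X] (p : envelopingSemigroup (ProbabilityMeasure X)) (x : X) :
    p.1 (diracProba x) = diracProba ((restriction p).1 x) :=
  (exists_restriction p).choose_spec x

/-- A compact metrizable `ℤ`-system is injective if `r : E(P(X)) → E(X)` is injective. -/
def IsInjectiveSystem (X : Type*) [TopologicalSpace X] [CompactSpace X]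
    [TopologicalSpace.MetrizableSpace X] [MeasurableSpace X] [BorelSpace X] [AddAction ℤ X]
    [ContinuousConstVAdd ℤ X] : Prop :=
  Function.Injective (restriction (X := X))

/-- Two points are proximal if `n_i + z` and `n_i + z'` converge to a common limit along some net
`(n_i)` in `ℤ`, that is, the orbit closure of `(z, z')` meets the diagonal. -/
def IsProximal {Z : Type*} [TopologicalSpace Z] [AddAction ℤ Z] (z z' : Z) : Prop :=
  ∃ w : Z, (w, w) ∈ closure (range fun n : ℤ => (n +ᵥ z, n +ᵥ z'))

/-! ### Subshifts of `{0,1}^ℤ` -/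

/-- The orbit closure of `x` under the shift `(S x)(n) = x (n + 1)`. -/
def orbitClosure (x : ℤ → Bool) : Set (ℤ → Bool) :=
  closure (range fun n : ℤ => SymbolicDynamics.FullShift.shift n x)

theorem shift_mem_orbitClosure {x y : ℤ → Bool} (n : ℤ) (hy : y ∈ orbitClosure x) :
    SymbolicDynamics.FullShift.shift n y ∈ orbitClosure x := by
  refine map_mem_closure (SymbolicDynamics.FullShift.continuous_shift n) hy ?_
  rintro _ ⟨m, rfl⟩
  exact ⟨m + n, SymbolicDynamics.FullShift.shift_add m n x⟩

/-- The `ℤ`-action generated by the shift: `(n +ᵥ y)(k) = y (n + k)`. -/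
instance orbitClosureAddAction (x : ℤ → Bool) : AddAction ℤ (orbitClosure x) where
  vadd n y := ⟨SymbolicDynamics.FullShift.shift n y.1, shift_mem_orbitClosure n y.2⟩
  zero_vadd y := Subtype.ext (SymbolicDynamics.FullShift.shift_zero y.1)
  add_vadd m n y := Subtype.ext (by
    change SymbolicDynamics.FullShift.shift (m + n) y.1 = _
    rw [add_comm]
    exact SymbolicDynamics.FullShift.shift_add n m y.1)

instance orbitClosureContinuousConstVAdd (x : ℤ → Bool) :
    ContinuousConstVAdd ℤ (orbitClosure x) where
  continuous_const_vadd n := Continuous.subtype_mk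
    ((SymbolicDynamics.FullShift.continuous_shift n).comp continuous_subtype_val) _

instance orbitClosureCompactSpace (x : ℤ → Bool) : CompactSpace (orbitClosure x) :=
  isCompact_iff_compactSpace.mp isClosed_closure.isCompact

/-- The Heaviside sequence: `0` at negative integers and `1` at non-negative ones. -/
def heaviside : ℤ → Bool := fun n => decide (0 ≤ n)

/-! ### Toeplitz sequences -/

/-- `Per_q(η)`: the positions at which `η` is constant along the residue class modulo `q`. -/
def perSet (η : ℤ → Bool) (q : ℕ) : Set ℤ :=
  {n | ∀ k : ℤ, η (n + k * q) = η n}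

/-- A Toeplitz sequence: every position is periodic, but the sequence is not. -/
def IsToeplitz (η : ℤ → Bool) : Prop :=
  (∀ n : ℤ, ∃ q : ℕ, 0 < q ∧ n ∈ perSet η q) ∧
    ¬ ∃ q : ℕ, 0 < q ∧ ∀ n : ℤ, n ∈ perSet η q

open Classical in
/-- A Toeplitz sequence is regular if the densities of the sets `Per_q(η)` have supremum `1`. -/
def IsRegularToeplitz (η : ℤ → Bool) : Prop :=
  ∀ ε : ℝ, 0 < ε → ∃ q : ℕ, 0 < q ∧
    1 - ε < (((Finset.Ico (0 : ℤ) q).filter (· ∈ perSet η q)).card : ℝ) / q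

/-- The adding machine `lim ℤ / p_i ℤ`. -/
def addingMachine (p : ℕ → ℕ) : Set ((i : ℕ) → ZMod (p i)) :=
  {g | ∀ i, ((g (i + 1)).cast : ZMod (p i)) = g i}

/-- The system `X` is an almost one-to-one extension of the adding machine `lim ℤ / p_i ℤ` with
the translation by `(1, 1, …)`. -/
def IsAlmostOneToOneExtension (X : Type*) [TopologicalSpace X] [AddAction ℤ X] (p : ℕ → ℕ) :
    Prop :=
  ∃ π : X → (i : ℕ) → ZMod (p i), Continuous π ∧ range π = addingMachine p ∧
    (∀ x i, π ((1 : ℤ) +ᵥ x) i = π x i + 1) ∧ Dense {x | ∀ x', π x' = π x → x' = x}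

open Classical in
/-- `J(i, n)`: the positions in `[n p_i, (n + 1) p_i)` that are outside `Per_{p_i}(η)`, i.e. not
yet filled after the `i`-th step of the construction of `η`. -/
noncomputable def holes (p : ℕ → ℕ) (η : ℤ → Bool) (i : ℕ) (n : ℤ) : Finset ℤ :=
  (Finset.Ico (n * p i) ((n + 1) * p i)).filter (· ∉ perSet η (p i))

/-- `η` reads the initial word of `y` along the positions in `J`, in increasing order. -/
def ReadsAlong (η : ℤ → Bool) (J : Finset ℤ) (y : ℤ → Bool) : Prop :=
  ∀ k ∈ J, η k = y ((J.filter (· < k)).card : ℤ)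

/-- `η` arises from the subshift `Y` by Williams' construction, with periods `p_i`. Since `Y` is
shift-invariant, the words of `Y` are the initial words of its elements. -/
structure IsWilliamsOver (Y : Set (ℤ → Bool)) (p : ℕ → ℕ) (η : ℤ → Bool) : Prop where
  zero : p 0 = 1
  lt : ∀ i, p i < p (i + 1)
  dvd : ∀ i, p i ∣ p (i + 1)
  /-- In each step, the set `J(i, n)` is either filled completely or left untouched. -/
  all_or_none : ∀ i n, (∀ k ∈ holes p η i n, k ∈ perSet η (p (i + 1))) ∨
    (∀ k ∈ holes p η i n, k ∉ perSet η (p (i + 1)))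
  /-- The two central sets `J(i, 0)` and `J(i, -1)` are filled in the next step. -/
  central : ∀ i, ∀ k ∈ holes p η i 0 ∪ holes p η i (-1), k ∈ perSet η (p (i + 1))
  /-- The sets `J(i, n)` are filled with words of `Y`. -/
  word : ∀ i n, ∃ y ∈ Y, ReadsAlong η (holes p η i n) y
  /-- Every word of `Y` of the right length is used. -/
  word_surj : ∀ i, ∀ y ∈ Y, ∃ n, ReadsAlong η (holes p η i n) y

/-!
The sequence `η` is explicit. Choose `p_{j+1} = p_j m_j` with `m_j` much larger than `p_j`. In step
`j`, a block `[b p_j, (b + 1) p_j)` is filled if its digit `t = (b + 1) mod m_j` is at most `p_j`,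
and its holes then receive `0` before the `t`-th position of the block and `1` from there on
(`eta`). Since `t` runs through `0, …, p_j`, the words read along the holes of a block are exactly
the monotone words, which are the words of the orbit closure `Y` of the Heaviside sequence
(`mem_orbitClosure_heaviside`). As `∑ (p_j + 1) / m_j ≤ 1 / 2`, the holes of every step have density
at least `1 / 2` (`half_le_holeCount_div`). Every `q` divides some `p_i`, so `Per_q(η)` avoids these
holes and has density at most `1 / 2`.

Every point `x` of the orbit closure `X` of `η` determines a unique element `g` of the adding machine
such that `x` is `η` translated by `g` at all positions filled by the construction (`Codes`). For
uniqueness, the `p_i`-periodic positions of `x` recover the set of holes of step `i` translated by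
`g`, and all periods of this set are multiples of `p_i` (`dvd_of_isHole_iff`). The relation is closed, so
`x ↦ g` is continuous. Integers are eventually filled, so moving `g` close to `0` moves all points
over `g` close to `η`: this gives minimality and the proximality of points in the same fibre.

Conversely, for `y ∈ Y`, filling the remaining holes over each `g` by reading `y` at the same
positions gives a point of `X` (`fill_mem_orbitClosure`), equivariantly in `(y, g)`. Pushing the Haar
measure forward gives a continuous equivariant map `fillLaw : Y → P(X)`. The Heaviside sequence
tends to the constants `0` and `1` under the shift, so its image `ν` tends to the images `μ₀` and
`μ₁` of the constants. These are factors of the ergodic Haar measure, and they differ because the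
remaining holes have positive measure.

Finally, the elements of `E(X)` that lift to an element of `E(P(X))` with `ν ↦ μ₀` form a closed left
ideal, and likewise for `μ₁`. Since the fibres over the adding machine are proximal, any two closed
left ideals of `E(X)` have a common element; it has two different lifts (`not_isInjectiveSystem`).
-/

namespace Williams

open SymbolicDynamics.FullShift (shift)

/-! ### Periods, digits and holes -/

/-- The periods `p_j`: `p_0 = 1` and `p_{j+1} = p_j m_j` with
`m_j = (p_j + 1) 2^{j+2} (j + 1)`. The factor `2^{j+2}` keeps the density of the holes above `1/2`,
and the factor `j + 1` makes every positive integer divide some period. -/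
def period : ℕ → ℕ
  | 0 => 1
  | j + 1 => period j * ((period j + 1) * 2 ^ (j + 2) * (j + 1))

/-- The ratio `m_j = p_{j+1} / p_j` of consecutive periods. -/
def ratio (j : ℕ) : ℕ := (period j + 1) * 2 ^ (j + 2) * (j + 1)

theorem period_succ (j : ℕ) : period (j + 1) = period j * ratio j := rfl

theorem period_succ_int (j : ℕ) : (period (j + 1) : ℤ) = period j * ratio j := by
  exact_mod_cast period_succ j

theorem ratio_pos (j : ℕ) : 0 < ratio j := by unfold ratio; positivity

theorem period_pos (j : ℕ) : 0 < period j := by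
  induction j with
  | zero => exact one_pos
  | succ j ih => rw [period_succ]; exact Nat.mul_pos ih (ratio_pos j)

theorem four_mul_le_ratio (j : ℕ) : 4 * (period j + 1) ≤ ratio j := by
  unfold ratio
  have h : 4 ≤ 2 ^ (j + 2) := by
    calc 4 = 2 ^ 2 := rfl
      _ ≤ 2 ^ (j + 2) := Nat.pow_le_pow_right two_pos (by omega)
  nlinarith [Nat.mul_le_mul (Nat.mul_le_mul (le_refl (period j + 1)) h) (Nat.le_add_left 1 j)]

theorem period_int_pos (j : ℕ) : (0 : ℤ) < period j := by exact_mod_cast period_pos j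

theorem ratio_int_pos (j : ℕ) : (0 : ℤ) < ratio j := by exact_mod_cast ratio_pos j

theorem period_lt_succ (j : ℕ) : period j < period (j + 1) := by
  rw [period_succ]
  nlinarith [four_mul_le_ratio j, period_pos j]

theorem lt_period_self (j : ℕ) : j < period j := by
  induction j with
  | zero => exact one_pos
  | succ j ih => have := period_lt_succ j; omega

theorem period_dvd_succ (j : ℕ) : period j ∣ period (j + 1) := ⟨_, period_succ j⟩

theorem period_dvd {i j : ℕ} (h : i ≤ j) : period i ∣ period j := by
  induction h with
  | refl => exact dvd_rfl
  | step _ ih => exact ih.trans (period_dvd_succ _)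

theorem dvd_period {q : ℕ} (hq : 0 < q) : q ∣ period q := by
  obtain ⟨j, rfl⟩ := Nat.exists_eq_succ_of_ne_zero hq.ne'
  exact ⟨period j * ((period j + 1) * 2 ^ (j + 2)), by rw [period, Nat.succ_eq_add_one]; ring⟩

/-- The residue modulo `m_j` of `b + 1`, where `b` is the index of the block
`[b p_j, (b + 1) p_j)` containing `k`. The shift by one gives the two central blocks `-1` and `0`
the digits `0` and `1`. -/
def digit (j : ℕ) (k : ℤ) : ℤ := (k / period j + 1) % ratio j

theorem digit_add_mul (j : ℕ) (k c : ℤ) : digit j (k + c * period (j + 1)) = digit j k := by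
  unfold digit
  rw [period_succ_int, show k + c * ((period j : ℤ) * ratio j) = k + (c * ratio j) * period j by ring,
    Int.add_mul_ediv_right _ _ (period_int_pos j).ne', add_right_comm, Int.add_mul_emod_self_right]

theorem digit_congr {i j : ℕ} (hij : j < i) {k k' : ℤ} (h : (period i : ℤ) ∣ k' - k) :
    digit j k' = digit j k := by
  obtain ⟨c, hc⟩ := (Int.natCast_dvd_natCast.2 (period_dvd (Nat.succ_le_of_lt hij))).trans h
  rw [show k' = k + c * period (j + 1) by rw [Nat.succ_eq_add_one] at hc; linarith, digit_add_mul]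

/-- The holes of the `i`-th step: the positions whose block of level `j` is left untouched by the
`j`-th step for all `j < i`; the `j`-th step fills the blocks with digit at most `p_j`. -/
def IsHole (i : ℕ) (k : ℤ) : Prop := ∀ j < i, (period j : ℤ) < digit j k

theorem isHole_succ {i : ℕ} {k : ℤ} :
    IsHole (i + 1) k ↔ IsHole i k ∧ (period i : ℤ) < digit i k := by
  refine ⟨fun h => ⟨fun j hj => h j (by omega), h i (by omega)⟩, fun h j hj => ?_⟩
  rcases Nat.lt_succ_iff_lt_or_eq.1 hj with hj | rfl
  exacts [h.1 j hj, h.2]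

theorem IsHole.mono {i j : ℕ} (hij : i ≤ j) {k : ℤ} (h : IsHole j k) : IsHole i k :=
  fun l hl => h l (by omega)

theorem isHole_congr {i : ℕ} {k k' : ℤ} (h : (period i : ℤ) ∣ k' - k) :
    IsHole i k' ↔ IsHole i k :=
  forall₂_congr fun j hj => by rw [digit_congr hj h]

theorem exists_filled_level {i : ℕ} {k : ℤ} (h : ¬ IsHole i k) :
    ∃ j < i, IsHole j k ∧ digit j k ≤ period j := by
  classical
  have h' : ∃ j, j < i ∧ digit j k ≤ period j := by
    simpa [IsHole] using h
  refine ⟨Nat.find h', (Nat.find_spec h').1, fun l hl => ?_, (Nat.find_spec h').2⟩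
  have := Nat.find_min h' hl
  by_contra hc
  exact this ⟨hl.trans (Nat.find_spec h').1, not_lt.1 hc⟩

theorem digit_le_of_mem_central {j : ℕ} {k : ℤ} (h₁ : -(period j : ℤ) ≤ k)
    (h₂ : k < period j * period j) : digit j k ≤ period j := by
  have hp := period_int_pos j
  have hm : 4 * ((period j : ℤ) + 1) ≤ ratio j := by exact_mod_cast four_mul_le_ratio j
  have h3 : -1 ≤ k / period j := (Int.le_ediv_iff_mul_le hp).2 (by linarith)
  have h4 : k / period j < period j := Int.ediv_lt_of_lt_mul hp h₂
  rw [digit, Int.emod_eq_of_lt (by omega) (by omega)]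
  omega

theorem exists_not_isHole_of_abs_le (N : ℕ) : ∃ i, ∀ k : ℤ, |k| ≤ N → ¬ IsHole i k := by
  refine ⟨N + 1 + 1, fun k hk h => ?_⟩
  have h1 := (isHole_succ.1 h).2
  have h2 : ((N + 1 : ℕ) : ℤ) < period (N + 1) := by exact_mod_cast lt_period_self (N + 1)
  have h3 := abs_le.1 hk
  push_cast at h2
  refine not_le.2 h1 (digit_le_of_mem_central (by omega) ?_)
  nlinarith

theorem exists_digit_le (k : ℤ) : ∃ j, digit j k ≤ period j := by
  obtain ⟨i, hi⟩ := exists_not_isHole_of_abs_le k.natAbs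
  obtain ⟨j, -, -, hj⟩ := exists_filled_level (hi k (by simp))
  exact ⟨j, hj⟩

/-! ### The Toeplitz sequence -/

/-- The sequence `η`. A position `k` is filled at the first level `j` with `digit j k ≤ p_j`, and
the holes of a block with digit `t` then receive `0` if they lie among the first `t` positions of
the block, and `1` otherwise. As `t` takes all values from `0` to `p_j`, all monotone words occur. -/
def eta (k : ℤ) : Bool :=
  decide (digit (Nat.find (exists_digit_le k)) k ≤ k % period (Nat.find (exists_digit_le k)))

theorem eta_eq {i : ℕ} {k : ℤ} (h : IsHole i k) (hi : digit i k ≤ period i) :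
    eta k = decide (digit i k ≤ k % period i) := by
  have : Nat.find (exists_digit_le k) = i :=
    (Nat.find_eq_iff _).2 ⟨hi, fun j hj => not_le.2 (h j hj)⟩
  rw [eta, this]

theorem eta_congr {i : ℕ} {k k' : ℤ} (hk : ¬ IsHole i k) (h : (period i : ℤ) ∣ k' - k) :
    eta k' = eta k := by
  obtain ⟨j, hj, hh, hd⟩ := exists_filled_level hk
  have hji : (period j : ℤ) ∣ k' - k :=
    (Int.natCast_dvd_natCast.2 (period_dvd hj.le)).trans h
  have hd' := digit_congr hj h
  rw [eta_eq hh hd, eta_eq ((isHole_congr hji).2 hh) (hd'.trans_le hd), hd',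
    (Int.emod_emod_of_dvd k' dvd_rfl).symm.trans (Int.emod_emod_of_dvd k' dvd_rfl),
    Int.ModEq.eq (Int.modEq_iff_dvd.2 hji)]

theorem ediv_period_eq {i j : ℕ} (hij : i ≤ j) {k k' : ℤ}
    (h : k / period i = k' / period i) : k / period j = k' / period j := by
  obtain ⟨c, hc⟩ := period_dvd hij
  rw [hc, Nat.cast_mul, ← Int.ediv_ediv_of_nonneg (by positivity),
    ← Int.ediv_ediv_of_nonneg (by positivity), h]

theorem digit_eq_of_ediv_eq {i j : ℕ} (hij : i ≤ j) {k k' : ℤ}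
    (h : k / period i = k' / period i) : digit j k = digit j k' := by
  rw [digit, digit, ediv_period_eq hij h]

/-- Along the holes of a block, `η` is monotone: all these holes are filled at the same level, where
they lie in a common block. -/
theorem eta_le_eta {i : ℕ} {k k' : ℤ} (h : IsHole i k) (h' : IsHole i k')
    (hb : k / period i = k' / period i) (hk : k ≤ k') : eta k ≤ eta k' := by
  have hn : ¬ IsHole (Nat.find (exists_digit_le k) + 1) k := fun hc =>
    not_le.2 (isHole_succ.1 hc).2 (Nat.find_spec (exists_digit_le k))
  obtain ⟨j, -, hj, hd⟩ := exists_filled_level hn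
  have hij : i ≤ j := by
    by_contra hc
    exact not_le.2 (h j (by omega)) hd
  have hdd := digit_eq_of_ediv_eq hij hb
  have hj' : IsHole j k' := fun l hl => by
    rcases lt_or_ge l i with hli | hli
    · exact h' l hli
    · rw [← digit_eq_of_ediv_eq hli hb]; exact hj l hl
  rw [eta_eq hj hd, eta_eq hj' (hdd ▸ hd), ← hdd]
  have hmod : k % period j ≤ k' % period j := by
    have h1 := Int.mul_ediv_add_emod k (period j)
    have h2 := Int.mul_ediv_add_emod k' (period j)
    rw [ediv_period_eq hij hb] at h1
    linarith
  rw [Bool.le_iff_imp, decide_eq_true_eq, decide_eq_true_eq]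
  exact fun hle => hle.trans hmod

/-- The block with index `t - 1` has digit `t`, so it is filled with threshold `t`. -/
theorem eta_add_mul_period {i : ℕ} {k : ℤ} (h : IsHole i k) (h0 : 0 ≤ k) (h1 : k < period i) {t : ℤ}
    (ht0 : 0 ≤ t) (ht : t ≤ period i) :
    IsHole i (k + (t - 1) * period i) ∧ digit i (k + (t - 1) * period i) = t ∧
      eta (k + (t - 1) * period i) = decide (t ≤ k) := by
  have hp := period_int_pos i
  have hm : 4 * ((period i : ℤ) + 1) ≤ ratio i := by exact_mod_cast four_mul_le_ratio i
  have hh : IsHole i (k + (t - 1) * period i) :=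
    (isHole_congr ⟨t - 1, by ring⟩).2 h
  have hd : digit i (k + (t - 1) * period i) = t := by
    rw [digit, Int.add_mul_ediv_right _ _ hp.ne', Int.ediv_eq_zero_of_lt h0 h1,
      show 0 + (t - 1) + 1 = t by ring, Int.emod_eq_of_lt ht0 (by omega)]
  refine ⟨hh, hd, ?_⟩
  rw [eta_eq hh (by rw [hd]; exact ht), hd, Int.add_mul_emod_self_right, Int.emod_eq_of_lt h0 h1]

/-- Every residue class modulo `p_i` of holes contains a position with any prescribed value that is
filled in the next step. -/
theorem exists_eta_eq {i : ℕ} {k : ℤ} (h : IsHole i k) (b : Bool) :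
    ∃ c : ℤ, ¬ IsHole (i + 1) (k + c * period i) ∧ eta (k + c * period i) = b := by
  have hp := period_int_pos i
  have h0 := Int.emod_nonneg k hp.ne'
  have h1 := Int.emod_lt_of_pos k hp
  have hk : IsHole i (k % period i) :=
    (isHole_congr ⟨-(k / period i), by linarith [Int.mul_ediv_add_emod k (period i)]⟩).2 h
  have key : ∀ t : ℤ, 0 ≤ t → t ≤ period i → decide (t ≤ k % period i) = b →
      ∃ c : ℤ, ¬ IsHole (i + 1) (k + c * period i) ∧ eta (k + c * period i) = b := by
    intro t ht0 ht htb
    obtain ⟨-, hd, he⟩ := eta_add_mul_period hk h0 h1 ht0 ht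
    refine ⟨t - 1 - k / period i, ?_⟩
    rw [show k + (t - 1 - k / period i) * period i = k % period i + (t - 1) * period i by
      linarith [Int.mul_ediv_add_emod k (period i)]]
    exact ⟨fun hc => not_le.2 (isHole_succ.1 hc).2 (hd.trans_le ht), he.trans htb⟩
  cases b
  · exact key (period i) hp.le le_rfl (by simpa using h1)
  · exact key 0 le_rfl hp.le (by simpa using h0)

theorem mem_perSet_period {i : ℕ} {k : ℤ} : k ∈ perSet eta (period i) ↔ ¬ IsHole i k := by
  refine ⟨fun hk h => ?_, fun hk c => eta_congr hk ⟨c, by ring⟩⟩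
  obtain ⟨c, -, hc⟩ := exists_eta_eq h (!(eta k))
  simp [hk c] at hc

/-! ### Density of the holes -/

open Classical in
/-- The number of holes of the `i`-th step in a period. -/
noncomputable def holeCount (i : ℕ) : ℕ :=
  ((Finset.Ico (0 : ℤ) (period i)).filter (IsHole i)).card

/-- The untouched blocks with index in `[p_i, m_i - 1)` contain a copy of all holes each. -/
theorem holeCount_succ (i : ℕ) :
    holeCount i * (ratio i - (period i + 1)) ≤ holeCount (i + 1) := by
  classical
  have hp := period_int_pos i
  have hm : 4 * (period i + 1) ≤ ratio i := four_mul_le_ratio i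
  have hcard : (Finset.Ico (period i : ℤ) (ratio i - 1)).card = ratio i - (period i + 1) := by
    rw [Int.card_Ico]; omega
  rw [holeCount, ← hcard, ← Finset.card_product]
  refine Finset.card_le_card_of_injOn (fun x : ℤ × ℤ => x.1 + x.2 * period i) ?_ ?_
  · rintro ⟨a, b⟩ hab
    simp only [Finset.coe_product, Finset.coe_filter, Finset.mem_Ico, Set.mem_prod,
      Set.mem_ofPred_eq, Finset.mem_coe] at hab ⊢
    obtain ⟨⟨⟨ha0, ha1⟩, hah⟩, hb0, hb1⟩ := hab
    have hd : digit i (a + b * period i) = b + 1 := by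
      rw [digit, Int.add_mul_ediv_right _ _ hp.ne', Int.ediv_eq_zero_of_lt ha0 ha1,
        zero_add, Int.emod_eq_of_lt (by omega) (by omega)]
    refine ⟨⟨by nlinarith, ?_⟩, isHole_succ.2 ⟨(isHole_congr ⟨b, by ring⟩).2 hah, by omega⟩⟩
    rw [period_succ_int]
    nlinarith
  · rintro ⟨a, b⟩ hab ⟨a', b'⟩ hab' h
    simp only [Finset.coe_product, Finset.coe_filter, Finset.mem_Ico, Set.mem_prod,
      Set.mem_ofPred_eq] at hab hab' h
    have e1 := congrArg (· / (period i : ℤ)) h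
    simp only [Int.add_mul_ediv_right _ _ hp.ne', Int.ediv_eq_zero_of_lt hab.1.1.1 hab.1.1.2,
      Int.ediv_eq_zero_of_lt hab'.1.1.1 hab'.1.1.2, zero_add] at e1
    subst e1
    simpa using h

/-- The `i`-th step loses a proportion `(p_i + 1) / m_i ≤ 2^{-(i+2)}` of the density; the stated bound is
the one that passes through the induction. -/
theorem half_add_le_holeCount_div (i : ℕ) :
    (1 / 2 : ℝ) + 1 / 2 ^ (i + 1) ≤ holeCount i / period i := by
  classical
  induction i with
  | zero =>
    have : holeCount 0 = 1 := by
      rw [holeCount, Finset.filter_true_of_mem (fun k _ j hj => by omega)]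
      simp [period]
    simp [this, period]; norm_num
  | succ i ih =>
    have h := holeCount_succ i
    have hm := four_mul_le_ratio i
    have hp : (0 : ℝ) < period i := by exact_mod_cast period_pos i
    have hr : (0 : ℝ) < ratio i := by exact_mod_cast ratio_pos i
    have hle : (holeCount i : ℝ) ≤ period i := by
      have : holeCount i ≤ period i := (Finset.card_filter_le _ _).trans (by simp)
      exact_mod_cast this
    have h' : (holeCount i : ℝ) * (ratio i - (period i + 1)) ≤ holeCount (i + 1) := by
      have : ((holeCount i * (ratio i - (period i + 1)) : ℕ) : ℝ) ≤ holeCount (i + 1) := by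
        exact_mod_cast h
      rw [Nat.cast_mul, Nat.cast_sub (by omega)] at this
      push_cast at this
      exact this
    have hfrac : ((period i : ℝ) + 1) / ratio i ≤ 1 / 2 ^ (i + 2) := by
      rw [div_le_div_iff₀ hr (by positivity), one_mul]
      have : (period i + 1) * 2 ^ (i + 2) ≤ ratio i := by
        unfold ratio; exact Nat.le_mul_of_pos_right _ (by omega)
      exact_mod_cast this
    have hstep : (holeCount i : ℝ) / period i - (period i + 1) / ratio i ≤
        holeCount (i + 1) / period (i + 1) := by
      rw [period_succ, Nat.cast_mul, le_div_iff₀ (by positivity)]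
      have e : ((holeCount i : ℝ) / period i - (period i + 1) / ratio i) * (period i * ratio i)
          = holeCount i * ratio i - (period i + 1) * period i := by
        field_simp
      rw [e]
      nlinarith
    have e2 : (1 : ℝ) / 2 ^ (i + 1) = 1 / 2 ^ (i + 2) + 1 / 2 ^ (i + 2) := by
      rw [pow_succ _ (i + 1)]; field_simp; norm_num
    rw [show i + 1 + 1 = i + 2 by ring]
    linarith

theorem half_le_holeCount_div (i : ℕ) : (1 / 2 : ℝ) ≤ holeCount i / period i :=
  le_trans (by simp) (half_add_le_holeCount_div i)

theorem exists_isHole_mem_block (i : ℕ) (n : ℤ) :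
    ∃ k, IsHole i k ∧ n * period i ≤ k ∧ k < (n + 1) * period i := by
  classical
  have h : 0 < holeCount i := by
    by_contra hc
    have := half_le_holeCount_div i
    simp only [not_lt, nonpos_iff_eq_zero] at hc
    rw [hc] at this
    norm_num at this
  obtain ⟨k, hk⟩ := Finset.card_pos.1 h
  rw [Finset.mem_filter, Finset.mem_Ico] at hk
  exact ⟨k + n * period i, (isHole_congr ⟨n, by ring⟩).2 hk.2, by linarith [hk.1.1],
    by linarith [hk.1.2]⟩

/-! ### The periods are essential -/

/-- The central run `[-p_j, p_j²)` without holes of level `j + 1` is contained in a single maximal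
such run, and modulo `p_{j+1}` no other run is as long; its right end is therefore fixed by all
symmetries of the set of holes. -/
theorem dvd_of_isHole_iff {i : ℕ} {a b : ℤ} (h : ∀ k, IsHole i (a + k) ↔ IsHole i (b + k)) :
    (period i : ℤ) ∣ b - a := by
  classical
  rcases i with _ | j
  · simp [period]
  have hp := period_int_pos j
  have hm : 4 * ((period j : ℤ) + 1) ≤ ratio j := by exact_mod_cast four_mul_le_ratio j
  obtain ⟨d, hd⟩ : ∃ d, d = b - a := ⟨_, rfl⟩
  have hinv : ∀ k, IsHole (j + 1) (k + d) ↔ IsHole (j + 1) k := fun k => by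
    have := h (k - a)
    rw [show a + (k - a) = k by ring, show b + (k - a) = k + d by rw [hd]; ring] at this
    exact this.symm
  obtain ⟨e, ⟨he0, heh⟩, hemin⟩ := Int.exists_least_of_bdd
    (P := fun k => 0 ≤ k ∧ IsHole (j + 1) k) ⟨0, fun k hk => hk.1⟩ (by
      obtain ⟨k, hk, hk0, -⟩ := exists_isHole_mem_block (j + 1) 0
      exact ⟨k, by simpa using hk0, hk⟩)
  have hcentral : ∀ k : ℤ, -(period j : ℤ) ≤ k → k < period j * period j → ¬ IsHole (j + 1) k :=
    fun k h1 h2 hc => not_le.2 (isHole_succ.1 hc).2 (digit_le_of_mem_central h1 h2)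
  have hesq : (period j : ℤ) * period j ≤ e := by
    by_contra hc
    exact hcentral e (by linarith) (not_le.1 hc) heh
  have hefree : ∀ k : ℤ, -(period j : ℤ) ≤ k → k < e → ¬ IsHole (j + 1) k := by
    intro k h1 h2 hc
    rcases lt_or_ge k 0 with h3 | h3
    · exact hcentral k h1 (by nlinarith) hc
    · exact not_le.2 h2 (hemin k ⟨h3, hc⟩)
  -- `n` is the index of the first full block of level `j` in the run ending at `e + d`
  obtain ⟨n, hn1, hn2⟩ : ∃ n : ℤ, d - period j ≤ n * period j ∧ (n + 1) * period j ≤ e + d := by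
    have h1 := Int.mul_ediv_add_emod (d - 1) (period j)
    have h2 := Int.emod_nonneg (d - 1) hp.ne'
    have h3 := Int.emod_lt_of_pos (d - 1) hp
    refine ⟨(d - 1) / period j, by nlinarith, ?_⟩
    nlinarith
  obtain ⟨x, hx, hx1, hx2⟩ := exists_isHole_mem_block j n
  have hxn : ¬ IsHole (j + 1) x := fun hc =>
    hefree (x - d) (by linarith) (by linarith) ((hinv (x - d)).1 (by simpa using hc))
  have hxd : digit j x ≤ period j := by
    by_contra hc
    exact hxn (isHole_succ.2 ⟨hx, not_le.1 hc⟩)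
  have hxdiv : x / period j = n := le_antisymm
    (Int.lt_add_one_iff.1 (Int.ediv_lt_of_lt_mul hp hx2)) ((Int.le_ediv_iff_mul_le hp).2 hx1)
  rw [digit, hxdiv] at hxd
  have hr0 := Int.emod_nonneg (n + 1) (ratio_int_pos j).ne'
  have hdm := Int.mul_ediv_add_emod (n + 1) (ratio j)
  generalize (n + 1) % (ratio j : ℤ) = r at *
  generalize (n + 1) / (ratio j : ℤ) = c at *
  obtain ⟨f, hf⟩ : ∃ f, f = e + d - c * period (j + 1) := ⟨_, rfl⟩
  have hfh : IsHole (j + 1) f :=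
    (isHole_congr ⟨-c, by rw [hf]; ring⟩).2 ((hinv e).2 heh)
  have hnp : (n + 1) * period j = r * period j + c * period (j + 1) := by
    rw [period_succ_int, ← hdm]; ring
  have hf0 : 0 ≤ f := by nlinarith
  have hef := hemin f ⟨hf0, hfh⟩
  have hfe : f ≤ e := by
    by_contra hc
    push Not at hc
    have h1 : ¬ IsHole (j + 1) (e + c * period (j + 1) - d) := by
      refine hefree _ ?_ (by linarith)
      have : r * period j ≤ period j * period j := mul_le_mul_of_nonneg_right hxd hp.le
      nlinarith
    refine h1 ((hinv _).1 ?_)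
    rw [sub_add_cancel]
    exact (isHole_congr ⟨c, by ring⟩).2 heh
  rw [← hd]
  exact ⟨c, by linarith [le_antisymm hfe hef]⟩

/-! ### Convergence of sequences and the orbit closure of the Heaviside sequence -/

theorem tendsto_of_forall_abs_le {u : ℕ → ℤ → Bool} {x : ℤ → Bool}
    (h : ∀ (N : ℕ) (k : ℤ), |k| ≤ N → u N k = x k) : Tendsto u atTop (𝓝 x) := by
  refine tendsto_pi_nhds.2 fun k => tendsto_const_nhds.congr' ?_
  filter_upwards [eventually_ge_atTop k.natAbs] with N hN
  exact (h N k (by have : |k| = (k.natAbs : ℤ) := Int.abs_eq_natAbs k; omega)).symm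

theorem mem_orbitClosure_of_forall {x z : ℤ → Bool}
    (h : ∀ N : ℕ, ∃ n : ℤ, ∀ k : ℤ, |k| ≤ N → z (n + k) = x k) : x ∈ orbitClosure z := by
  choose n hn using h
  exact mem_closure_of_tendsto (tendsto_of_forall_abs_le (u := fun N => shift (n N) z) hn)
    (Eventually.of_forall fun N => ⟨n N, rfl⟩)

/-- On a bounded interval, a monotone sequence is a translate of the Heaviside sequence. -/
theorem exists_threshold {y : ℤ → Bool} (hy : Monotone y) {a b : ℤ} (hab : a ≤ b) :
    ∃ s, a ≤ s ∧ s ≤ b ∧ ∀ k, a ≤ k → k < b → y k = decide (s ≤ k) := by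
  by_cases h : ∃ k, a ≤ k ∧ y k = true
  · obtain ⟨s, ⟨has, hs⟩, hmin⟩ := Int.exists_least_of_bdd
      (P := fun k => a ≤ k ∧ y k = true) ⟨a, fun k hk => hk.1⟩ h
    refine ⟨min s b, le_min has hab, min_le_right _ _, fun k hak hkb => ?_⟩
    rw [Bool.eq_iff_iff, decide_eq_true_eq]
    refine ⟨fun hk => (min_le_left _ _).trans (hmin k ⟨hak, hk⟩), fun hk => ?_⟩
    have hsk : s ≤ k := by omega
    exact Bool.le_iff_imp.1 (hy hsk) hs
  · push Not at h
    refine ⟨b, hab, le_rfl, fun k hak hkb => ?_⟩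
    rw [Bool.eq_iff_iff, decide_eq_true_eq]
    exact ⟨fun hk => absurd hk (h k hak), fun hk => by omega⟩

theorem mem_orbitClosure_heaviside {y : ℤ → Bool} : y ∈ orbitClosure heaviside ↔ Monotone y := by
  constructor
  · intro hy
    have hcl : IsClosed {y : ℤ → Bool | Monotone y} := by
      have : {y : ℤ → Bool | Monotone y} = ⋂ (a : ℤ) (b : ℤ) (_ : a ≤ b),
          (fun y : ℤ → Bool => (y a, y b)) ⁻¹' {q | q.1 ≤ q.2} := by
        ext y; simp [Monotone]
      rw [this]
      exact isClosed_iInter fun a => isClosed_iInter fun b => isClosed_iInter fun _ =>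
        (isClosed_discrete _).preimage (by fun_prop)
    refine closure_minimal ?_ hcl hy
    rintro _ ⟨n, rfl⟩ a b hab
    change decide (0 ≤ n + a) ≤ decide (0 ≤ n + b)
    rw [Bool.le_iff_imp, decide_eq_true_eq, decide_eq_true_eq]
    intro h
    omega
  · intro hy
    refine mem_orbitClosure_of_forall fun N => ?_
    obtain ⟨s, -, -, hs⟩ := exists_threshold hy (a := -N) (b := N + 1) (by omega)
    refine ⟨-s, fun k hk => ?_⟩
    have hk' := abs_le.1 hk
    rw [hs k (by omega) (by omega), heaviside]
    exact decide_eq_decide.2 (by omega)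

/-! ### Williams' construction -/

open Classical in
theorem mem_holes {i : ℕ} {n k : ℤ} :
    k ∈ holes period eta i n ↔ (n * period i ≤ k ∧ k < (n + 1) * period i) ∧ IsHole i k := by
  rw [holes, Finset.mem_filter, Finset.mem_Ico, mem_perSet_period, not_not]

theorem ediv_eq_of_mem_holes {i : ℕ} {n k : ℤ} (hk : k ∈ holes period eta i n) :
    k / period i = n :=
  le_antisymm (Int.lt_add_one_iff.1 (Int.ediv_lt_of_lt_mul (period_int_pos i) (mem_holes.1 hk).1.2))
    ((Int.le_ediv_iff_mul_le (period_int_pos i)).2 (mem_holes.1 hk).1.1)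

theorem mem_perSet_succ_iff {i : ℕ} {n k : ℤ} (hk : k ∈ holes period eta i n) :
    k ∈ perSet eta (period (i + 1)) ↔ (n + 1) % (ratio i : ℤ) ≤ period i := by
  rw [mem_perSet_period, isHole_succ, not_and, not_lt, digit, ediv_eq_of_mem_holes hk]
  exact ⟨fun h => h (mem_holes.1 hk).2, fun h _ => h⟩

theorem exists_readsAlong {η : ℤ → Bool} {J : Finset ℤ} (h : MonotoneOn η J) :
    ∃ y, Monotone y ∧ ReadsAlong η J y := by
  classical
  refine ⟨fun r => decide (∃ k ∈ J, η k = true ∧ ((J.filter (· < k)).card : ℤ) ≤ r),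
    fun r r' hr => ?_, fun k hk => ?_⟩
  · rw [Bool.le_iff_imp, decide_eq_true_eq, decide_eq_true_eq]
    rintro ⟨k, hk, h1, h2⟩
    exact ⟨k, hk, h1, h2.trans hr⟩
  · rw [Bool.eq_iff_iff, decide_eq_true_eq]
    refine ⟨fun h1 => ⟨k, hk, h1, le_rfl⟩, ?_⟩
    rintro ⟨k', hk', h1, h2⟩
    have hle : k' ≤ k := by
      by_contra hc
      push Not at hc
      have hlt : (J.filter (· < k)).card < (J.filter (· < k')).card := by
        refine Finset.card_lt_card ⟨fun l hl => ?_, fun hsub => ?_⟩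
        · rw [Finset.mem_filter] at hl ⊢
          exact ⟨hl.1, hl.2.trans hc⟩
        · have := hsub (Finset.mem_filter.2 ⟨hk, hc⟩)
          simp at this
      omega
    exact Bool.le_iff_imp.1 (h hk' hk hle) h1

/-- The rank of a hole in its block is the rank of its translate in the block at `0`. -/
theorem card_filter_holes_lt (i : ℕ) (n k : ℤ) :
    ((holes period eta i n).filter (· < k)).card =
      ((holes period eta i 0).filter (· < k - n * period i)).card := by
  refine Finset.card_bij (fun l _ => l - n * period i) (fun l hl => ?_)
    (fun _ _ _ _ h => by simpa using h) (fun l hl => ⟨l + n * period i, ?_, by simp⟩)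
  · rw [Finset.mem_filter, mem_holes] at hl ⊢
    refine ⟨⟨⟨by linarith [hl.1.1.1], by linarith [hl.1.1.2]⟩,
      (isHole_congr ⟨-n, by ring⟩).2 hl.1.2⟩, by linarith [hl.2]⟩
  · rw [Finset.mem_filter, mem_holes] at hl ⊢
    refine ⟨⟨⟨by linarith [hl.1.1.1], by linarith [hl.1.1.2]⟩,
      (isHole_congr ⟨n, by ring⟩).2 hl.1.2⟩, by linarith [hl.2]⟩

theorem isWilliamsOver_eta : IsWilliamsOver (orbitClosure heaviside) period eta where
  zero := rfl
  lt := period_lt_succ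
  dvd := period_dvd_succ
  all_or_none i n := by
    rcases le_or_gt ((n + 1) % (ratio i : ℤ)) (period i) with h | h
    · exact Or.inl fun k hk => (mem_perSet_succ_iff hk).2 h
    · exact Or.inr fun k hk hc => not_le.2 h ((mem_perSet_succ_iff hk).1 hc)
  central i k hk := by
    have hp := period_int_pos i
    have hm : 4 * ((period i : ℤ) + 1) ≤ ratio i := by exact_mod_cast four_mul_le_ratio i
    rcases Finset.mem_union.1 hk with hk | hk
    · rw [mem_perSet_succ_iff hk, Int.emod_eq_of_lt (by omega) (by omega)]; omega
    · rw [mem_perSet_succ_iff hk]; simp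
  word i n := by
    obtain ⟨y, hy, h⟩ := exists_readsAlong (η := eta) (J := holes period eta i n)
      fun k hk k' hk' hkk => eta_le_eta (mem_holes.1 hk).2 (mem_holes.1 hk').2
        ((ediv_eq_of_mem_holes hk).trans (ediv_eq_of_mem_holes hk').symm) hkk
    exact ⟨y, mem_orbitClosure_heaviside.2 hy, h⟩
  word_surj i y hy := by
    have hy := mem_orbitClosure_heaviside.1 hy
    have hmono : Monotone fun k : ℤ => y (((holes period eta i 0).filter (· < k)).card : ℤ) := by
      intro k k' hk
      refine hy (Int.ofNat_le.2 (Finset.card_le_card fun l hl => ?_))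
      rw [Finset.mem_filter] at hl ⊢
      exact ⟨hl.1, hl.2.trans_le hk⟩
    obtain ⟨t, ht0, ht, hyt⟩ := exists_threshold hmono (period_int_pos i).le
    refine ⟨t - 1, fun k hk => ?_⟩
    obtain ⟨⟨h1, h2⟩, h3⟩ := mem_holes.1 hk
    have h0 : 0 ≤ k - (t - 1) * period i := by linarith
    have hlt : k - (t - 1) * period i < period i := by linarith
    rw [card_filter_holes_lt, hyt _ h0 hlt]
    have := (eta_add_mul_period ((isHole_congr ⟨-(t - 1), by ring⟩).2 h3) h0 hlt ht0 ht).2.2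
    rwa [sub_add_cancel] at this

theorem isToeplitz_eta : IsToeplitz eta := by
  constructor
  · intro n
    obtain ⟨i, hi⟩ := exists_not_isHole_of_abs_le n.natAbs
    exact ⟨period i, period_pos i, mem_perSet_period.2 (hi n (by simp))⟩
  · rintro ⟨q, hq, h⟩
    obtain ⟨k, hk, -⟩ := exists_isHole_mem_block q 0
    obtain ⟨c, hc⟩ := dvd_period hq
    refine mem_perSet_period.1 (?_ : k ∈ perSet eta (period q)) hk
    intro l
    rw [hc, show k + l * ((q * c : ℕ) : ℤ) = k + (l * c) * q by push_cast; ring]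
    exact h k _

theorem not_isRegularToeplitz_eta : ¬ IsRegularToeplitz eta := by
  classical
  intro h
  obtain ⟨q, hq, hlt⟩ := h (1 / 2) (by norm_num)
  obtain ⟨c, hc⟩ := dvd_period hq
  have hcpos : 0 < c := Nat.pos_of_mul_pos_left (hc ▸ period_pos q)
  have hqi : (0 : ℤ) < q := by exact_mod_cast hq
  -- translates of `Per_q(η) ∩ [0, q)` inside `[0, p_q)`
  have hcard : c * ((Finset.Ico (0 : ℤ) q).filter (· ∈ perSet eta q)).card + holeCount q ≤
      period q := by
    have h1 : c * ((Finset.Ico (0 : ℤ) q).filter (· ∈ perSet eta q)).card ≤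
        ((Finset.Ico (0 : ℤ) (period q)).filter (fun k => ¬ IsHole q k)).card := by
      rw [mul_comm, ← Finset.card_range c, ← Finset.card_product]
      refine Finset.card_le_card_of_injOn (fun x : ℤ × ℕ => x.1 + x.2 * q) ?_ ?_
      · rintro ⟨a, b⟩ hab
        simp only [Finset.coe_product, Finset.coe_filter, Finset.mem_Ico, Set.mem_prod,
          Set.mem_ofPred_eq, Finset.mem_coe, Finset.mem_range] at hab ⊢
        obtain ⟨⟨⟨ha0, ha1⟩, hap⟩, hb⟩ := hab
        refine ⟨⟨by positivity, ?_⟩, mem_perSet_period.1 fun l => ?_⟩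
        · rw [hc]
          have : (b : ℤ) + 1 ≤ c := by exact_mod_cast hb
          push_cast
          nlinarith
        · rw [hc, show a + b * q + l * ((q * c : ℕ) : ℤ) = a + (b + l * c) * q by push_cast; ring,
            hap, hap]
      · rintro ⟨a, b⟩ hab ⟨a', b'⟩ hab' he
        simp only [Finset.coe_product, Finset.coe_filter, Finset.mem_Ico, Set.mem_prod,
          Set.mem_ofPred_eq] at hab hab' he
        have e1 := congrArg (· / (q : ℤ)) he
        simp only [Int.add_mul_ediv_right _ _ hqi.ne', Int.ediv_eq_zero_of_lt hab.1.1.1 hab.1.1.2,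
          Int.ediv_eq_zero_of_lt hab'.1.1.1 hab'.1.1.2, zero_add, Nat.cast_inj] at e1
        subst e1
        simpa using he
    have h2 := Finset.card_filter_add_card_filter_not (s := Finset.Ico (0 : ℤ) (period q))
      (IsHole q)
    rw [Int.card_Ico, sub_zero, Int.toNat_natCast] at h2
    unfold holeCount
    omega
  have hhalf := half_le_holeCount_div q
  have hpr : (0 : ℝ) < period q := by exact_mod_cast period_pos q
  have hqr : (0 : ℝ) < q := by exact_mod_cast hq
  have hcr : (0 : ℝ) < c := by exact_mod_cast hcpos
  have hcr' : (period q : ℝ) = q * c := by exact_mod_cast hc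
  have hcard' : (c : ℝ) * ((Finset.Ico (0 : ℤ) q).filter (· ∈ perSet eta q)).card + holeCount q ≤
      period q := by exact_mod_cast hcard
  rw [le_div_iff₀ hpr] at hhalf
  rw [lt_div_iff₀ hqr] at hlt
  nlinarith

/-! ### Coding by the adding machine -/

/-- The adding machine as a subgroup of the product of the groups `ℤ / p_i ℤ`. -/
def odometer : AddSubgroup ((i : ℕ) → ZMod (period i)) where
  carrier := addingMachine period
  zero_mem' i := by simp
  add_mem' {a b} ha hb i := by
    simp only [Pi.add_apply, ZMod.cast_add (period_dvd_succ i), ha i, hb i]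
  neg_mem' {a} ha i := by
    simp only [Pi.neg_apply, ZMod.cast_neg (period_dvd_succ i), ha i]

theorem mem_odometer {g : (i : ℕ) → ZMod (period i)} : g ∈ odometer ↔ g ∈ addingMachine period :=
  Iff.rfl

theorem isClosed_odometer : IsClosed (odometer : Set ((i : ℕ) → ZMod (period i))) := by
  have : (odometer : Set ((i : ℕ) → ZMod (period i))) =
      ⋂ i, {g | ((g (i + 1)).cast : ZMod (period i)) = g i} := by
    ext g; simp [mem_odometer, addingMachine]
  rw [this]
  exact isClosed_iInter fun i => isClosed_eq
    ((continuous_of_discreteTopology (f := fun a : ZMod (period (i + 1)) =>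
      (a.cast : ZMod (period i)))).comp (continuous_apply (i + 1))) (continuous_apply i)

instance : ∀ i, NeZero (period i) := fun i => ⟨(period_pos i).ne'⟩

instance : CompactSpace odometer := isCompact_iff_compactSpace.1 isClosed_odometer.isCompact

/-- The image of an integer in the adding machine. -/
def intPoint (n : ℤ) : odometer :=
  ⟨fun _ => n, fun i => ZMod.cast_intCast (period_dvd_succ i) n⟩

theorem intCast_eq_of_le (g : odometer) {i j : ℕ} (hij : i ≤ j) {n : ℤ}
    (hn : (n : ZMod (period j)) = g.1 j) : (n : ZMod (period i)) = g.1 i := by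
  induction hij with
  | refl => exact hn
  | @step j hij ih =>
    refine ih ?_
    have := g.2 j
    rw [← this, ← hn, ZMod.cast_intCast (period_dvd_succ j)]

theorem dvd_sub_of_intCast_eq (g : odometer) {i j : ℕ} (hij : i ≤ j) {n m : ℤ}
    (hn : (n : ZMod (period i)) = g.1 i) (hm : (m : ZMod (period j)) = g.1 j) :
    (period i : ℤ) ∣ m - n :=
  (ZMod.intCast_eq_intCast_iff_dvd_sub n m (period i)).1 (hn.trans (intCast_eq_of_le g hij hm).symm)

theorem exists_intCast_eq (g : odometer) (i : ℕ) : ∃ n : ℤ, (n : ZMod (period i)) = g.1 i :=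
  ZMod.intCast_surjective (g.1 i)

/-- `x` agrees with `η` translated by `g` at all positions that the construction fills. -/
def Codes (x : ℤ → Bool) (g : (i : ℕ) → ZMod (period i)) : Prop :=
  ∀ (i : ℕ) (n : ℤ), (n : ZMod (period i)) = g i → ∀ k, ¬ IsHole i (n + k) → x k = eta (n + k)

theorem isClosed_codes :
    IsClosed {z : (ℤ → Bool) × ((i : ℕ) → ZMod (period i)) | Codes z.1 z.2} := by
  have : {z : (ℤ → Bool) × ((i : ℕ) → ZMod (period i)) | Codes z.1 z.2} = ⋂ (i : ℕ) (n : ℤ) (k : ℤ),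
      (fun z : (ℤ → Bool) × ((i : ℕ) → ZMod (period i)) => (z.1 k, z.2 i)) ⁻¹'
        {q | (n : ZMod (period i)) = q.2 → ¬ IsHole i (n + k) → q.1 = eta (n + k)} := by
    ext z
    simp only [Codes, mem_iInter, mem_preimage, Set.mem_ofPred_eq]
    exact ⟨fun h i n k h1 h2 => h i n h1 k h2, fun h i n h1 k h2 => h i n k h1 h2⟩
  rw [this]
  exact isClosed_iInter fun i => isClosed_iInter fun n => isClosed_iInter fun k =>
    (isClosed_discrete _).preimage (by fun_prop)

theorem codes_shift {x : ℤ → Bool} {g : (i : ℕ) → ZMod (period i)} (h : Codes x g) (m : ℤ) :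
    Codes (shift m x) (fun i => g i + m) := by
  intro i n hn k hk
  have := h i (n - m) (by rw [Int.cast_sub, hn, add_sub_cancel_right]) (m + k)
  rw [show n - m + (m + k) = n + k by ring] at this
  exact this hk

theorem codes_eta : Codes eta (intPoint 0).1 := by
  intro i n hn k hk
  have hd := dvd_sub_of_intCast_eq (intPoint 0) le_rfl hn (m := 0) rfl
  have := eta_congr (k' := k) hk (by convert hd using 1; ring)
  exact this

theorem isClosed_setOf_exists_codes {C : Set ((i : ℕ) → ZMod (period i))} (hC : IsClosed C) :
    IsClosed {x | ∃ g ∈ C, Codes x g} := by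
  have : {x | ∃ g ∈ C, Codes x g} =
      Prod.fst '' ({z : (ℤ → Bool) × ((i : ℕ) → ZMod (period i)) | Codes z.1 z.2} ∩
        Prod.snd ⁻¹' C) := by
    ext x
    constructor
    · rintro ⟨g, hg, h⟩
      exact ⟨(x, g), ⟨h, hg⟩, rfl⟩
    · rintro ⟨⟨x, g⟩, ⟨h, hg⟩, rfl⟩
      exact ⟨g, hg, h⟩
  rw [this]
  exact ((isClosed_codes.inter (hC.preimage continuous_snd)).isCompact.image continuous_fst).isClosed

theorem exists_codes {x : ℤ → Bool} (hx : x ∈ orbitClosure eta) : ∃ g : odometer, Codes x g.1 := by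
  have hx' := closure_minimal ?_ (isClosed_setOf_exists_codes isClosed_odometer) hx
  · obtain ⟨g, hg, h⟩ := hx'
    exact ⟨⟨g, hg⟩, h⟩
  · rintro _ ⟨n, rfl⟩
    refine ⟨(intPoint n).1, (intPoint n).2, ?_⟩
    convert codes_shift codes_eta n using 2 with i
    simp [intPoint]

/-- The `p_i`-periodic positions of `x` are those filled by the `i`-th step: every class of holes of
the `i`-th step receives both values in the next one. -/
theorem Codes.mem_perSet_iff {x : ℤ → Bool} {g : odometer} (h : Codes x g.1) {i : ℕ} {n : ℤ}
    (hn : (n : ZMod (period i)) = g.1 i) (k : ℤ) :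
    k ∈ perSet x (period i) ↔ ¬ IsHole i (n + k) := by
  constructor
  · intro hk hh
    obtain ⟨n', hn'⟩ := exists_intCast_eq g (i + 1)
    have hd := dvd_sub_of_intCast_eq g (Nat.le_succ i) hn hn'
    have hh' : IsHole i (n' + k) := (isHole_congr (by convert hd using 1; ring)).2 hh
    obtain ⟨c, hc, hc'⟩ := exists_eta_eq hh' (!(x k))
    rw [add_assoc] at hc hc'
    have := h (i + 1) n' hn' (k + c * period i) hc
    rw [hk c, hc'] at this
    simp at this
  · intro hh c
    have hp : ¬ IsHole i (n + (k + c * period i)) := by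
      rwa [isHole_congr (k := n + k) ⟨c, by ring⟩]
    rw [h i n hn _ hp, h i n hn _ hh]
    exact eta_congr hh ⟨c, by ring⟩

theorem Codes.unique {x : ℤ → Bool} {g g' : odometer} (h : Codes x g.1) (h' : Codes x g'.1) :
    g = g' := by
  refine Subtype.ext (funext fun i => ?_)
  obtain ⟨n, hn⟩ := exists_intCast_eq g i
  obtain ⟨n', hn'⟩ := exists_intCast_eq g' i
  rw [← hn, ← hn', ZMod.intCast_eq_intCast_iff_dvd_sub]
  refine dvd_of_isHole_iff fun k => not_iff_not.1 ?_
  rw [← h.mem_perSet_iff hn, ← h'.mem_perSet_iff hn']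

theorem Codes.apply_sub {x : ℤ → Bool} {g : (i : ℕ) → ZMod (period i)} (h : Codes x g) {i : ℕ}
    {n : ℤ} (hn : (n : ZMod (period i)) = g i) {k : ℤ} (hk : ¬ IsHole i k) :
    x (-n + k) = eta k := by
  have := h i n hn (-n + k)
  rw [add_neg_cancel_left] at this
  exact this hk

/-- Points over the same element of the adding machine are brought simultaneously towards `η`. -/
theorem exists_shift_eq_eta (g : odometer) (N : ℕ) :
    ∃ n : ℤ, ∀ x, Codes x g.1 → ∀ k : ℤ, |k| ≤ N → x (n + k) = eta k := by
  obtain ⟨i, hi⟩ := exists_not_isHole_of_abs_le N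
  obtain ⟨n, hn⟩ := exists_intCast_eq g i
  exact ⟨-n, fun x hx k hk => hx.apply_sub hn (hi k hk)⟩

/-! ### Filling the remaining holes -/

/-- The position `k` over `g` is filled by no step of the construction. -/
def IsFreeHole (g : (i : ℕ) → ZMod (period i)) (k : ℤ) : Prop :=
  ∀ (i : ℕ) (n : ℤ), (n : ZMod (period i)) = g i → IsHole i (n + k)

open Classical in
/-- The sequence over `g` whose remaining holes are filled by reading `y` at the same positions. -/
noncomputable def fill (y : ℤ → Bool) (g : (i : ℕ) → ZMod (period i)) (k : ℤ) : Bool :=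
  decide ((∃ (i : ℕ) (n : ℤ), (n : ZMod (period i)) = g i ∧ ¬ IsHole i (n + k) ∧
    eta (n + k) = true) ∨ IsFreeHole g k ∧ y k = true)

open Classical in
theorem fill_eq_true_iff {y : ℤ → Bool} {g : (i : ℕ) → ZMod (period i)} {k : ℤ} :
    fill y g k = true ↔ (∃ (i : ℕ) (n : ℤ), (n : ZMod (period i)) = g i ∧ ¬ IsHole i (n + k) ∧
      eta (n + k) = true) ∨ IsFreeHole g k ∧ y k = true :=
  decide_eq_true_iff

theorem fill_of_isFreeHole {y : ℤ → Bool} {g : (i : ℕ) → ZMod (period i)} {k : ℤ}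
    (h : IsFreeHole g k) : fill y g k = y k := by
  rw [Bool.eq_iff_iff, fill_eq_true_iff]
  refine ⟨?_, fun hy => Or.inr ⟨h, hy⟩⟩
  rintro (⟨i, n, hn, hh, -⟩ | hy)
  exacts [absurd (h i n hn) hh, hy.2]

theorem isHole_of_le (g : odometer) {i j : ℕ} (hij : i ≤ j) {n m k : ℤ}
    (hn : (n : ZMod (period i)) = g.1 i) (hm : (m : ZMod (period j)) = g.1 j)
    (h : IsHole j (m + k)) : IsHole i (n + k) := by
  have := dvd_sub_of_intCast_eq g hij hn hm
  exact (isHole_congr (by convert this using 1; ring)).1 (h.mono hij)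

theorem codes_fill (y : ℤ → Bool) (g : odometer) : Codes (fill y g.1) g.1 := by
  intro i n hn k hk
  rw [Bool.eq_iff_iff, fill_eq_true_iff]
  refine ⟨?_, fun hy => Or.inl ⟨i, n, hn, hk, hy⟩⟩
  rintro (⟨j, m, hm, hh, he⟩ | hy)
  · rw [← he]
    rcases le_total i j with hij | hij
    · have := dvd_sub_of_intCast_eq g hij hn hm
      exact (eta_congr hk (by convert this using 1; ring)).symm
    · have := dvd_sub_of_intCast_eq g hij hm hn
      exact eta_congr hh (by convert this using 1; ring)
  · exact absurd (hy.1 i n hn) hk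

theorem isFreeHole_add {g : (i : ℕ) → ZMod (period i)} {m k : ℤ} :
    IsFreeHole (fun i => g i + m) k ↔ IsFreeHole g (m + k) := by
  constructor
  · intro h i n hn
    have := h i (n + m) (by rw [Int.cast_add, hn])
    rwa [add_assoc] at this
  · intro h i n hn
    have := h i (n - m) (by rw [Int.cast_sub, hn, add_sub_cancel_right])
    rwa [show n - m + (m + k) = n + k by ring] at this

theorem fill_shift (y : ℤ → Bool) (g : odometer) (m : ℤ) :
    fill (shift m y) (g + intPoint m).1 = shift m (fill y g.1) := by
  funext k
  by_cases h : IsFreeHole (g + intPoint m).1 k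
  · rw [fill_of_isFreeHole h]
    exact (fill_of_isFreeHole (isFreeHole_add.1 h)).symm
  · obtain ⟨i, n, hn, hh⟩ : ∃ (i : ℕ) (n : ℤ),
        (n : ZMod (period i)) = (g + intPoint m).1 i ∧ ¬ IsHole i (n + k) := by
      simpa [IsFreeHole] using h
    rw [codes_fill _ _ i n hn k hh]
    exact (codes_shift (codes_fill y g) m i n hn k hh).symm

/-- In a bounded window, the holes of any sufficiently late step are never filled. -/
theorem exists_level_window (g : odometer) (N : ℕ) : ∃ i₀, ∀ i ≥ i₀, ∀ n : ℤ,
    (n : ZMod (period i)) = g.1 i → ∀ k : ℤ, |k| ≤ N → IsHole i (n + k) → IsFreeHole g.1 k := by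
  have h : ∀ k ∈ Finset.Icc (-N : ℤ) N, ∀ᶠ i in atTop, ∀ n : ℤ,
      (n : ZMod (period i)) = g.1 i → IsHole i (n + k) → IsFreeHole g.1 k := by
    intro k _
    by_cases hk : IsFreeHole g.1 k
    · exact Eventually.of_forall fun _ _ _ _ => hk
    · obtain ⟨i, n, hn, hh⟩ : ∃ (i : ℕ) (n : ℤ),
          (n : ZMod (period i)) = g.1 i ∧ ¬ IsHole i (n + k) := by
        simpa [IsFreeHole] using hk
      filter_upwards [eventually_ge_atTop i] with j hj m hm hmk
      exact absurd (isHole_of_le g hj hn hm hmk) hh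
  obtain ⟨i₀, hi₀⟩ := eventually_atTop.1 ((Filter.eventually_all_finset _).2 h)
  exact ⟨i₀, fun i hi n hn k hk => hi₀ i hi k (Finset.mem_Icc.2 (abs_le.1 hk)) n hn⟩

theorem not_isFreeHole_intPoint (m k : ℤ) : ¬ IsFreeHole (intPoint m).1 k := by
  intro h
  obtain ⟨i, hi⟩ := exists_not_isHole_of_abs_le (m + k).natAbs
  exact hi (m + k) (by simp) (h i m rfl)

/-- A window of bounded length lies inside a single block of high level, unless `g` is the image of
an integer; then there are no holes to fill. -/
theorem fill_mem_orbitClosure {y : ℤ → Bool} (hy : Monotone y) (g : odometer) :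
    fill y g.1 ∈ orbitClosure eta := by
  refine mem_orbitClosure_of_forall fun N => ?_
  obtain ⟨i₀, hi₀⟩ := exists_level_window g N
  by_cases hcase : ∃ i ≥ i₀, ∃ n : ℤ, (n : ZMod (period i)) = g.1 i ∧ (N : ℤ) ≤ n ∧
      n + N < period i
  · obtain ⟨i, hi, n, hn, hn1, hn2⟩ := hcase
    obtain ⟨s, hs1, hs2, hs⟩ := exists_threshold hy (a := -N) (b := N + 1) (by omega)
    refine ⟨n + (n + s - 1) * period i, fun k hk => ?_⟩
    have hk' := abs_le.1 hk
    rw [add_right_comm]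
    by_cases hh : IsHole i (n + k)
    · rw [fill_of_isFreeHole (hi₀ i hi n hn k hk hh), hs k (by omega) (by omega),
        (eta_add_mul_period hh (by omega) (by omega) (t := n + s) (by omega) (by omega)).2.2]
      exact decide_eq_decide.2 (by omega)
    · rw [codes_fill y g i n hn k hh]
      exact eta_congr hh ⟨n + s - 1, by ring⟩
  · push Not at hcase
    have hfree : ∀ k, ¬ IsFreeHole g.1 k := by
      -- some `k` in the window is congruent to `-g` modulo infinitely many periods
      have hk : ∀ i ≥ i₀, ∃ k ∈ Finset.Icc (-N : ℤ) N, ((-k : ℤ) : ZMod (period i)) = g.1 i := by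
        intro i hi
        obtain ⟨m, hm⟩ := exists_intCast_eq g i
        have hp := period_int_pos i
        have h0 := Int.emod_nonneg m hp.ne'
        have h1 := Int.emod_lt_of_pos m hp
        have hn : ((m % period i : ℤ) : ZMod (period i)) = g.1 i := by
          rw [← hm]; simp
        rcases le_or_gt (N : ℤ) (m % period i) with hle | hlt
        · have h2 := hcase i hi _ hn hle
          refine ⟨period i - m % period i, Finset.mem_Icc.2 ⟨by omega, by omega⟩, ?_⟩
          rw [← hn]; simp
        · exact ⟨-(m % period i), Finset.mem_Icc.2 ⟨by omega, by omega⟩, by rw [neg_neg, hn]⟩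
      have hfreq : ∃ᶠ i in atTop, ∃ k ∈ Finset.Icc (-N : ℤ) N,
          ((-k : ℤ) : ZMod (period i)) = g.1 i :=
        (eventually_atTop.2 ⟨i₀, hk⟩).frequently
      obtain ⟨k, -, hk⟩ : ∃ k ∈ Finset.Icc (-N : ℤ) N, ∃ᶠ i in atTop,
          ((-k : ℤ) : ZMod (period i)) = g.1 i := by
        by_contra hc
        push Not at hc
        refine hfreq ?_
        filter_upwards [(Filter.eventually_all_finset _).2 hc]
          with i hi ⟨k, hk, hke⟩
        exact hi k hk hke
      have hg : g = intPoint (-k) := by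
        refine Subtype.ext (funext fun i => ?_)
        obtain ⟨j, hj, hjk⟩ := (frequently_atTop.1 hk) i
        exact (intCast_eq_of_le g hj hjk).symm
      rw [hg]
      exact not_isFreeHole_intPoint _
    obtain ⟨n, hn⟩ := exists_intCast_eq g i₀
    refine ⟨n, fun k hk => (codes_fill y g i₀ n hn k fun hh => ?_).symm⟩
    exact hfree k (hi₀ i₀ le_rfl n hn k hk hh)

/-! ### The topological dynamics of the orbit closure -/

theorem isMinimal_orbitClosure_eta : AddAction.IsMinimal ℤ (orbitClosure eta) := by
  refine ⟨fun x z => ?_⟩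
  have hη : eta ∈ orbitClosure x.1 := by
    obtain ⟨g, hg⟩ := exists_codes x.2
    refine mem_orbitClosure_of_forall fun N => ?_
    obtain ⟨n, hn⟩ := exists_shift_eq_eta g N
    exact ⟨n, hn x.1 hg⟩
  have hz : z.1 ∈ orbitClosure x.1 := by
    refine closure_minimal ?_ isClosed_closure z.2
    rintro _ ⟨n, rfl⟩
    exact shift_mem_orbitClosure n hη
  rw [closure_subtype]
  convert hz using 1
  unfold orbitClosure
  congr 1
  exact (range_comp _ _).symm

/-- The factor map onto the adding machine. -/
noncomputable def toOdometer (x : orbitClosure eta) : odometer := (exists_codes x.2).choose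

theorem codes_toOdometer (x : orbitClosure eta) : Codes x.1 (toOdometer x).1 :=
  (exists_codes x.2).choose_spec

theorem toOdometer_eq {x : orbitClosure eta} {g : odometer} (h : Codes x.1 g.1) :
    toOdometer x = g :=
  (codes_toOdometer x).unique h

theorem continuous_toOdometer : Continuous toOdometer := by
  refine continuous_induced_rng.2 (continuous_iff_isClosed.2 fun C hC => ?_)
  have := (isClosed_setOf_exists_codes (hC.inter isClosed_odometer)).preimage
    (continuous_subtype_val (p := (· ∈ orbitClosure eta)))
  convert this using 1
  ext x
  constructor
  · intro hx
    exact ⟨_, ⟨hx, (toOdometer x).2⟩, codes_toOdometer x⟩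
  · rintro ⟨g, ⟨hgC, hg⟩, h⟩
    have := toOdometer_eq (g := ⟨g, hg⟩) h
    rw [mem_preimage, Function.comp_apply, this]
    exact hgC

theorem toOdometer_vadd (n : ℤ) (x : orbitClosure eta) :
    toOdometer (n +ᵥ x) = toOdometer x + intPoint n :=
  toOdometer_eq (codes_shift (codes_toOdometer x) n)

/-- The fibres over the integers are singletons, since no holes remain there; they form the orbit of
`η`. -/
theorem isAlmostOneToOneExtension_eta :
    IsAlmostOneToOneExtension (orbitClosure eta) period := by
  refine ⟨fun x => (toOdometer x).1, continuous_subtype_val.comp continuous_toOdometer, ?_, ?_, ?_⟩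
  · refine Subset.antisymm (range_subset_iff.2 fun x => (toOdometer x).2) fun g hg => ?_
    refine ⟨⟨_, fill_mem_orbitClosure (y := fun _ => false) monotone_const ⟨g, hg⟩⟩, ?_⟩
    exact congrArg Subtype.val (toOdometer_eq
      (x := ⟨_, fill_mem_orbitClosure monotone_const ⟨g, hg⟩⟩) (codes_fill _ ⟨g, hg⟩))
  · intro x i
    change (toOdometer ((1 : ℤ) +ᵥ x)).1 i = _
    rw [toOdometer_vadd]
    simp [intPoint]
  · have hη : eta ∈ orbitClosure eta := subset_closure ⟨0, SymbolicDynamics.FullShift.shift_zero _⟩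
    refine (isMinimal_orbitClosure_eta.dense_orbit ⟨eta, hη⟩).mono ?_
    rintro _ ⟨m, rfl⟩ x' hx'
    have hcode : Codes (shift m eta) (intPoint m).1 := by
      convert codes_shift codes_eta m using 2 with i
      simp [intPoint]
    have hx : Codes x'.1 (intPoint m).1 := by
      have h2 := codes_toOdometer x'
      have hx'' : toOdometer x' = toOdometer (m +ᵥ (⟨eta, hη⟩ : orbitClosure eta)) :=
        Subtype.ext hx'
      rwa [hx''.trans (toOdometer_eq (g := intPoint m) hcode)] at h2
    refine Subtype.ext (funext fun k => ?_)
    obtain ⟨i, n, hn, hh⟩ : ∃ (i : ℕ) (n : ℤ),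
        (n : ZMod (period i)) = (intPoint m).1 i ∧ ¬ IsHole i (n + k) := by
      simpa [IsFreeHole] using not_isFreeHole_intPoint m k
    exact (hx i n hn k hh).trans (hcode i n hn k hh).symm

/-- Points over the same element of the adding machine are proximal. -/
theorem isProximal_of_toOdometer_eq {x x' : orbitClosure eta} (h : toOdometer x = toOdometer x') :
    IsProximal x x' := by
  have hη : eta ∈ orbitClosure eta := subset_closure ⟨0, SymbolicDynamics.FullShift.shift_zero _⟩
  choose n hn using exists_shift_eq_eta (toOdometer x)
  refine ⟨⟨eta, hη⟩, mem_closure_of_tendsto (b := atTop)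
    (f := fun N : ℕ => (n N +ᵥ x, n N +ᵥ x')) (Tendsto.prodMk_nhds ?_ ?_)
    (Eventually.of_forall fun N => ⟨n N, rfl⟩)⟩
  · exact tendsto_subtype_rng.2 (tendsto_of_forall_abs_le (u := fun N => shift (n N) x.1)
      fun N => hn N x.1 (codes_toOdometer x))
  · exact tendsto_subtype_rng.2 (tendsto_of_forall_abs_le (u := fun N => shift (n N) x'.1)
      fun N => hn N x'.1 (h ▸ codes_toOdometer x'))

/-! ### Left ideals of compact right topological semigroups -/

section Semigroup

variable {M : Type*} [Semigroup M] [TopologicalSpace M]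

/-- Nonempty closed left ideals. -/
structure IsClosedLeftIdeal (I : Set M) : Prop where
  isClosed : IsClosed I
  nonempty : I.Nonempty
  mul_mem : ∀ q, ∀ a ∈ I, q * a ∈ I

theorem exists_minimal_isClosedLeftIdeal [CompactSpace M] {A : Set M} (hA : IsClosedLeftIdeal A) :
    ∃ I ⊆ A, IsClosedLeftIdeal I ∧ ∀ I' ⊆ I, IsClosedLeftIdeal I' → I' = I := by
  obtain ⟨I, hI⟩ : ∃ I, Minimal (· ∈ {I : Set M | I ⊆ A ∧ IsClosedLeftIdeal I}) I := by
    refine zorn_superset _ fun c hc hchain => ?_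
    rcases c.eq_empty_or_nonempty with rfl | hne
    · exact ⟨A, ⟨Subset.rfl, hA⟩, by simp⟩
    · refine ⟨⋂₀ c, ⟨?_, ⟨isClosed_sInter fun s hs => (hc hs).2.isClosed, ?_, ?_⟩⟩,
        fun s hs => sInter_subset_of_mem hs⟩
      · obtain ⟨s, hs⟩ := hne
        exact (sInter_subset_of_mem hs).trans (hc hs).1
      · have : Nonempty c := hne.to_subtype
        exact IsCompact.nonempty_sInter_of_directed_nonempty_isCompact_isClosed
          (fun s hs t ht => (hchain.total hs ht).elim (fun h => ⟨s, hs, Subset.rfl, h⟩)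
            fun h => ⟨t, ht, h, Subset.rfl⟩) (fun s hs => (hc hs).2.nonempty)
          (fun s hs => (hc hs).2.isClosed.isCompact) (fun s hs => (hc hs).2.isClosed)
      · exact fun q a ha s hs => (hc hs).2.mul_mem q a (ha s hs)
  exact ⟨I, hI.prop.1, hI.prop.2, fun I' hI' h => hI.eq_of_subset ⟨hI'.trans hI.prop.1, h⟩ hI'⟩

/-- Any two closed left ideals contain idempotents `v` and `u` with `u v = v` such that `u`
generates a minimal left ideal. -/
theorem exists_idempotents [CompactSpace M] [T2Space M] (hc : ∀ r : M, Continuous (· * r))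
    {A B : Set M} (hA : IsClosedLeftIdeal A) (hB : IsClosedLeftIdeal B) :
    ∃ v ∈ A, ∃ u ∈ B, v * v = v ∧ u * u = u ∧ u * v = v ∧ ∀ q, ∃ s, s * (q * u) = u := by
  obtain ⟨I, hIA, hI, hImin⟩ := exists_minimal_isClosedLeftIdeal hA
  obtain ⟨J, hJB, hJ, hJmin⟩ := exists_minimal_isClosedLeftIdeal hB
  obtain ⟨v, hv, hvv⟩ := exists_idempotent_in_compact_subsemigroup hc I hI.nonempty
    hI.isClosed.isCompact fun x _ y hy => hI.mul_mem x y hy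
  -- `J v` is a closed left ideal inside the minimal one `I`, so some `w ∈ J` satisfies `w v = v`
  have hJv : (· * v) '' J = I := by
    refine hImin _ ?_ ⟨(hJ.isClosed.isCompact.image (hc v)).isClosed, hJ.nonempty.image _, ?_⟩
    · rintro _ ⟨a, -, rfl⟩
      exact hI.mul_mem a v hv
    · rintro q _ ⟨a, ha, rfl⟩
      exact ⟨q * a, hJ.mul_mem q a ha, mul_assoc q a v⟩
  have hcl : IsClosed (J ∩ {w | w * v = v}) :=
    hJ.isClosed.inter (isClosed_eq (hc v) continuous_const)
  obtain ⟨u, ⟨huJ, huv⟩, huu⟩ := exists_idempotent_in_compact_subsemigroup hc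
    (J ∩ {w | w * v = v}) (by obtain ⟨w, hw, hwv⟩ := hJv.ge hv; exact ⟨w, hw, hwv⟩)
    hcl.isCompact (by
      rintro x ⟨hx, hxv⟩ y ⟨hy, hyv⟩
      refine ⟨hJ.mul_mem x y hy, ?_⟩
      rw [Set.mem_ofPred_eq] at hxv hyv ⊢
      rw [mul_assoc, hyv, hxv])
  refine ⟨v, hIA hv, u, hJB huJ, hvv, huu, huv, fun q => ?_⟩
  have hqu : range (· * (q * u)) = J := by
    refine hJmin _ ?_ ⟨(isCompact_range (hc (q * u))).isClosed, ⟨_, u, rfl⟩, ?_⟩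
    · rintro _ ⟨a, rfl⟩
      exact hJ.mul_mem _ _ (hJ.mul_mem _ _ huJ)
    · rintro s _ ⟨a, rfl⟩
      exact ⟨s * a, mul_assoc s a _⟩
  exact hqu.ge huJ

end Semigroup

/-! ### Enveloping semigroups -/

section Enveloping

variable {Z : Type*} [TopologicalSpace Z] [AddAction ℤ Z]

theorem comp_mem_envelopingSemigroup [ContinuousConstVAdd ℤ Z] {p q : Z → Z}
    (hp : p ∈ envelopingSemigroup Z) (hq : q ∈ envelopingSemigroup Z) :
    p ∘ q ∈ envelopingSemigroup Z := by
  have h1 : ∀ n : ℤ, (fun z => n +ᵥ z) ∘ q ∈ envelopingSemigroup Z := by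
    intro n
    have hc : Continuous fun (f : Z → Z) => (fun z => n +ᵥ z) ∘ f :=
      continuous_pi fun z => (continuous_const_vadd n).comp (continuous_apply z)
    refine map_mem_closure hc hq ?_
    rintro _ ⟨m, rfl⟩
    exact ⟨n + m, funext fun z => add_vadd n m z⟩
  have hc : Continuous fun (f : Z → Z) => f ∘ q :=
    continuous_pi fun z => continuous_apply (q z)
  refine closure_minimal ?_ (isClosed_closure.preimage hc) hp
  rintro _ ⟨n, rfl⟩
  exact h1 n

/-- Composition in the enveloping semigroup. -/
@[reducible] def envelopingSemigroupSemigroup [ContinuousConstVAdd ℤ Z] :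
    Semigroup (envelopingSemigroup Z) where
  mul p q := ⟨p.1 ∘ q.1, comp_mem_envelopingSemigroup p.2 q.2⟩
  mul_assoc _ _ _ := rfl

theorem apply_eq_of_mem_envelopingSemigroup [T2Space Z] {p : Z → Z}
    (hp : p ∈ envelopingSemigroup Z) {z : Z} (hz : ∀ n : ℤ, n +ᵥ z = z) : p z = z := by
  refine closure_minimal ?_ (isClosed_eq (continuous_apply z) continuous_const :
    IsClosed {f : Z → Z | f z = z}) hp
  rintro _ ⟨n, rfl⟩
  exact hz n

theorem exists_mem_envelopingSemigroup_of_tendsto [CompactSpace Z] [T2Space Z] {l : Filter ℤ}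
    [l.NeBot] {z w : Z} (h : Tendsto (fun n : ℤ => n +ᵥ z) l (𝓝 w)) :
    ∃ p ∈ envelopingSemigroup Z, p z = w := by
  have hK : IsCompact (envelopingSemigroup Z) := isClosed_closure.isCompact
  obtain ⟨p, hp, hle⟩ := hK.ultrafilter_le_nhds
    ((Ultrafilter.of l).map fun (n : ℤ) (z : Z) => n +ᵥ z)
    (le_principal_iff.2 (Eventually.of_forall fun n => subset_closure ⟨n, rfl⟩ :
      ∀ᶠ n in (Ultrafilter.of l : Filter ℤ), (fun z : Z => n +ᵥ z) ∈ envelopingSemigroup Z))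
  have h1 : Tendsto (fun (n : ℤ) (z : Z) => n +ᵥ z) (Ultrafilter.of l : Filter ℤ) (𝓝 p) := hle
  exact ⟨p, hp, tendsto_nhds_unique (tendsto_pi_nhds.1 h1 z) (h.mono_left (Ultrafilter.of_le l))⟩

theorem exists_apply_eq_of_isProximal [CompactSpace Z] [T2Space Z] {z z' : Z} (h : IsProximal z z') :
    ∃ q ∈ envelopingSemigroup Z, q z = q z' := by
  obtain ⟨w, hw⟩ := h
  have hK : IsCompact (envelopingSemigroup Z) := isClosed_closure.isCompact
  have hc : Continuous fun q : Z → Z => (q z, q z') := by fun_prop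
  have hsub : range (fun n : ℤ => (n +ᵥ z, n +ᵥ z')) ⊆
      (fun q : Z → Z => (q z, q z')) '' envelopingSemigroup Z := by
    rintro _ ⟨n, rfl⟩
    exact ⟨fun z => n +ᵥ z, subset_closure ⟨n, rfl⟩, rfl⟩
  obtain ⟨q, hq, he⟩ := closure_minimal hsub (hK.image hc).isClosed hw
  exact ⟨q, hq, (congrArg Prod.fst he).trans (congrArg Prod.snd he).symm⟩

/-- Over a factor on which `ℤ` acts by translations, idempotents preserve the fibres. -/
theorem apply_idempotent_eq {K : Type*} [AddCommGroup K] [TopologicalSpace K]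
    [IsTopologicalAddGroup K] [T2Space K] {π : Z → K} (hπ : Continuous π) {a : ℤ → K}
    (ha : ∀ n z, π (n +ᵥ z) = π z + a n) {v : Z → Z} (hv : v ∈ envelopingSemigroup Z)
    (hvv : ∀ z, v (v z) = v z) (z : Z) : π (v z) = π z := by
  have hcl : IsClosed {f : Z → Z | π (f z) - π z = π (f (v z)) - π (v z)} :=
    isClosed_eq ((hπ.comp (continuous_apply z)).sub continuous_const)
      ((hπ.comp (continuous_apply (v z))).sub continuous_const)
  have h : π (v z) - π z = π (v (v z)) - π (v z) := by
    refine closure_minimal ?_ hcl hv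
    rintro _ ⟨n, rfl⟩
    change π (n +ᵥ z) - π z = π (n +ᵥ v z) - π (v z)
    rw [ha, ha, add_sub_cancel_left, add_sub_cancel_left]
  rwa [hvv, sub_self, sub_eq_zero] at h

end Enveloping

section Injective

theorem isClosed_setOf_exists_extension {X : Type*} [TopologicalSpace X] [CompactSpace X]
    [TopologicalSpace.MetrizableSpace X] [MeasurableSpace X] [BorelSpace X]
    {C : Set (ProbabilityMeasure X → ProbabilityMeasure X)}
    (hC : IsClosed C) :
    IsClosed {q : X → X | ∃ p ∈ C, ∀ x, p (diracProba x) = diracProba (q x)} := by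
  have : {q : X → X | ∃ p ∈ C, ∀ x, p (diracProba x) = diracProba (q x)} = Prod.fst ''
      (Prod.snd ⁻¹' C ∩ ⋂ x, {z : (X → X) × (ProbabilityMeasure X → ProbabilityMeasure X) |
        z.2 (diracProba x) = diracProba (z.1 x)}) := by
    ext q
    constructor
    · rintro ⟨p, hp, h⟩
      exact ⟨(q, p), ⟨hp, mem_iInter.2 h⟩, rfl⟩
    · rintro ⟨⟨q, p⟩, ⟨hp, h⟩, rfl⟩
      exact ⟨p, hp, mem_iInter.1 h⟩
  rw [this]
  refine (IsCompact.image (IsClosed.isCompact ?_) continuous_fst).isClosed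
  refine (hC.preimage continuous_snd).inter (isClosed_iInter fun x => isClosed_eq ?_ ?_)
  · exact (continuous_apply (diracProba x)).comp continuous_snd
  · exact continuous_diracProba.comp ((continuous_apply x).comp continuous_fst)

variable {X : Type*} [TopologicalSpace X] [CompactSpace X] [TopologicalSpace.MetrizableSpace X]
  [MeasurableSpace X] [BorelSpace X] [AddAction ℤ X] [ContinuousConstVAdd ℤ X]

instance : ContinuousConstVAdd ℤ (ProbabilityMeasure X) :=
  ⟨fun n => ProbabilityMeasure.continuous_map (continuous_const_vadd n)⟩

/-- The restriction `E(P(X)) → E(X)` is surjective. -/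
theorem exists_extension {q : X → X} (hq : q ∈ envelopingSemigroup X) :
    ∃ p ∈ envelopingSemigroup (ProbabilityMeasure X),
      ∀ x, p (diracProba x) = diracProba (q x) := by
  refine closure_minimal ?_ (isClosed_setOf_exists_extension isClosed_closure) hq
  rintro _ ⟨n, rfl⟩
  exact ⟨fun μ => n +ᵥ μ, subset_closure ⟨n, rfl⟩, vadd_diracProba n⟩

/-- The restrictions to `X` of the elements of `E(P(X))` that move `ν` to a fixed point `μ` of the
action form a left ideal. -/
theorem isClosedLeftIdeal_restrictions {ν μ : ProbabilityMeasure X} {l : Filter ℤ} [l.NeBot]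
    (h : Tendsto (fun n : ℤ => n +ᵥ ν) l (𝓝 μ)) (hμ : ∀ n : ℤ, n +ᵥ μ = μ) :
    let := envelopingSemigroupSemigroup (Z := X)
    IsClosedLeftIdeal {q : envelopingSemigroup X |
      ∃ p ∈ envelopingSemigroup (ProbabilityMeasure X) ∩ {p | p ν = μ},
        ∀ x, p (diracProba x) = diracProba (q.1 x)} := by
  let := envelopingSemigroupSemigroup (Z := X)
  have hC : IsClosed (envelopingSemigroup (ProbabilityMeasure X) ∩ {p | p ν = μ}) :=
    isClosed_closure.inter (isClosed_eq (continuous_apply ν) continuous_const)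
  refine ⟨(isClosed_setOf_exists_extension hC).preimage continuous_subtype_val, ?_, ?_⟩
  · obtain ⟨p, hp, hpν⟩ := exists_mem_envelopingSemigroup_of_tendsto h
    exact ⟨restriction ⟨p, hp⟩, p, ⟨hp, hpν⟩, restriction_spec ⟨p, hp⟩⟩
  · rintro s q ⟨p, ⟨hp, hpν⟩, hpq⟩
    obtain ⟨t, ht, hts⟩ := exists_extension s.2
    refine ⟨t ∘ p, ⟨comp_mem_envelopingSemigroup ht hp, ?_⟩, fun x => ?_⟩
    · change t (p ν) = μ
      rw [show p ν = μ from hpν]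
      exact apply_eq_of_mem_envelopingSemigroup ht hμ
    · change t (p (diracProba x)) = diracProba (s.1 (q.1 x))
      rw [hpq, hts]

/-- If the fibres over a factor on which `ℤ` acts by translations are proximal, then all minimal
left ideals of `E(X)` have the same idempotents, so the two left ideals of elements that lift to
maps `ν ↦ μ₀` and `ν ↦ μ₁` meet. -/
theorem not_isInjectiveSystem {K : Type*} [AddCommGroup K] [TopologicalSpace K]
    [IsTopologicalAddGroup K] [T2Space K] {π : X → K} (hπ : Continuous π) {a : ℤ → K}
    (ha : ∀ n x, π (n +ᵥ x) = π x + a n) (hprox : ∀ x x', π x = π x' → IsProximal x x')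
    {ν μ₀ μ₁ : ProbabilityMeasure X} {l₀ l₁ : Filter ℤ} [l₀.NeBot] [l₁.NeBot]
    (h₀ : Tendsto (fun n : ℤ => n +ᵥ ν) l₀ (𝓝 μ₀)) (h₁ : Tendsto (fun n : ℤ => n +ᵥ ν) l₁ (𝓝 μ₁))
    (hμ₀ : ∀ n : ℤ, n +ᵥ μ₀ = μ₀) (hμ₁ : ∀ n : ℤ, n +ᵥ μ₁ = μ₁) (hne : μ₀ ≠ μ₁) :
    ¬ IsInjectiveSystem X := by
  intro hinj
  let := envelopingSemigroupSemigroup (Z := X)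
  have : CompactSpace (envelopingSemigroup X) :=
    isCompact_iff_compactSpace.1 isClosed_closure.isCompact
  have hc : ∀ r : envelopingSemigroup X, Continuous (· * r) := fun r =>
    continuous_induced_rng.2 (continuous_pi fun x =>
      (continuous_apply (r.1 x)).comp continuous_subtype_val)
  obtain ⟨v, hv, u, hu, hvv, huu, huv, hmin⟩ := exists_idempotents hc
    (isClosedLeftIdeal_restrictions h₀ hμ₀) (isClosedLeftIdeal_restrictions h₁ hμ₁)
  have happ : ∀ {p q r : envelopingSemigroup X}, p * q = r → ∀ x, p.1 (q.1 x) = r.1 x :=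
    fun h x => congrFun (congrArg Subtype.val h) x
  -- `q` merges the proximal points `v x` and `u x`; both are fixed by `u = s q u`
  have hvu : ∀ x, v.1 x = u.1 x := by
    intro x
    have hfib : π (v.1 x) = π (u.1 x) :=
      (apply_idempotent_eq hπ ha v.2 (happ hvv) x).trans
        (apply_idempotent_eq hπ ha u.2 (happ huu) x).symm
    obtain ⟨q, hq, hqe⟩ := exists_apply_eq_of_isProximal (hprox _ _ hfib)
    obtain ⟨s, hs⟩ := hmin ⟨q, hq⟩
    have hsq : ∀ y, s.1 (q (u.1 y)) = u.1 y := happ hs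
    calc v.1 x = s.1 (q (u.1 (v.1 x))) := by rw [hsq, happ huv]
      _ = s.1 (q (u.1 (u.1 x))) := by rw [happ huv, hqe, happ huu]
      _ = u.1 x := by rw [hsq, happ huu]
  obtain ⟨p₀, ⟨hp₀, hp₀ν⟩, hr₀⟩ := hv
  obtain ⟨p₁, ⟨hp₁, hp₁ν⟩, hr₁⟩ := hu
  have hr : restriction ⟨p₀, hp₀⟩ = restriction ⟨p₁, hp₁⟩ := by
    refine Subtype.ext (funext fun x => injective_diracProba ?_)
    change diracProba _ = diracProba _
    rw [← restriction_spec, ← restriction_spec]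
    exact (hr₀ x).trans ((congrArg diracProba (hvu x)).trans (hr₁ x).symm)
  have hp : p₀ = p₁ := congrArg Subtype.val (hinj hr)
  exact hne (hp₀ν.symm.trans ((congrFun hp ν).trans hp₁ν))

/-- A measure is proximal to the limits of its orbit. -/
theorem isProximal_of_tendsto {Z : Type*} [TopologicalSpace Z] [AddAction ℤ Z] {z w : Z}
    {l : Filter ℤ} [l.NeBot] (h : Tendsto (fun n : ℤ => n +ᵥ z) l (𝓝 w))
    (hw : ∀ n : ℤ, n +ᵥ w = w) : IsProximal z w :=
  ⟨w, mem_closure_of_tendsto (h.prodMk_nhds ((tendsto_const_nhds (x := w)).congr fun n => (hw n).symm))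
    (Eventually.of_forall fun n => ⟨n, rfl⟩)⟩

theorem isProximal_symm {Z : Type*} [TopologicalSpace Z] [AddAction ℤ Z] {z z' : Z}
    (h : IsProximal z z') : IsProximal z' z := by
  obtain ⟨w, hw⟩ := h
  refine ⟨w, (map_mem_closure continuous_swap hw ?_ : Prod.swap (w, w) ∈ _)⟩
  rintro _ ⟨n, rfl⟩
  exact ⟨n, rfl⟩

theorem not_isProximal_of_fixed {Z : Type*} [TopologicalSpace Z] [T2Space Z] [AddAction ℤ Z]
    {z z' : Z} (hz : ∀ n : ℤ, n +ᵥ z = z) (hz' : ∀ n : ℤ, n +ᵥ z' = z') (hne : z ≠ z') :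
    ¬ IsProximal z z' := by
  rintro ⟨w, hw⟩
  simp only [hz, hz', range_const, closure_singleton, mem_singleton_iff, Prod.mk.injEq] at hw
  exact hne (hw.1.symm.trans hw.2)

end Injective

/-! ### Measures on the orbit closure -/

instance (n : ℕ) : BorelSpace (ZMod n) := ⟨borel_eq_top_of_discrete.symm⟩

instance : SecondCountableTopology odometer :=
  inferInstanceAs (SecondCountableTopology (odometer : Set ((i : ℕ) → ZMod (period i))))

/-- The normalized Haar measure of the adding machine. -/
noncomputable def haar : Measure odometer := Measure.addHaarMeasure ⊤

instance : haar.IsAddHaarMeasure := inferInstanceAs (Measure.addHaarMeasure _).IsAddHaarMeasure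

instance : IsProbabilityMeasure haar := ⟨Measure.addHaarMeasure_self (K₀ := ⊤)⟩

theorem measurableSet_intCast_eq (i : ℕ) (n : ℤ) :
    MeasurableSet {g : odometer | (n : ZMod (period i)) = g.1 i} := by
  have : IsOpen ((fun g : odometer => g.1 i) ⁻¹' {a | (n : ZMod (period i)) = a}) :=
    (isOpen_discrete _).preimage ((continuous_apply i).comp continuous_subtype_val)
  exact this.measurableSet

theorem measurableSet_isFreeHole (k : ℤ) : MeasurableSet {g : odometer | IsFreeHole g.1 k} := by
  have : {g : odometer | IsFreeHole g.1 k} = ⋂ (i : ℕ) (n : ℤ) (_ : ¬ IsHole i (n + k)),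
      {g : odometer | (n : ZMod (period i)) = g.1 i}ᶜ := by
    ext g
    simp only [IsFreeHole, mem_iInter, Set.mem_ofPred_eq, mem_compl_iff]
    exact ⟨fun h i n h1 h2 => h1 (h i n h2), fun h i n h1 => not_not.1 fun h2 => h i n h2 h1⟩
  rw [this]
  exact .iInter fun i => .iInter fun n => .iInter fun _ => (measurableSet_intCast_eq i n).compl

/-- The point over `g` whose remaining holes are filled by reading `y`. -/
noncomputable def fillPoint (y : orbitClosure heaviside) (g : odometer) : orbitClosure eta :=
  ⟨fill y.1 g.1, fill_mem_orbitClosure (mem_orbitClosure_heaviside.1 y.2) g⟩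

theorem measurableSet_fill_eq_true (y : ℤ → Bool) (k : ℤ) :
    MeasurableSet {g : odometer | fill y g.1 k = true} := by
  have : {g : odometer | fill y g.1 k = true} =
      (⋃ (i : ℕ) (n : ℤ) (_ : ¬ IsHole i (n + k) ∧ eta (n + k) = true),
        {g : odometer | (n : ZMod (period i)) = g.1 i}) ∪
      ({g : odometer | IsFreeHole g.1 k} ∩ {_g : odometer | y k = true}) := by
    ext g
    simp only [fill_eq_true_iff, mem_union, mem_iUnion, mem_inter_iff, Set.mem_ofPred_eq]
    refine or_congr ⟨?_, ?_⟩ Iff.rfl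
    · rintro ⟨i, n, h1, h2⟩
      exact ⟨i, n, h2, h1⟩
    · rintro ⟨i, n, h2, h1⟩
      exact ⟨i, n, h1, h2⟩
  rw [this]
  exact (MeasurableSet.iUnion fun i => .iUnion fun n => .iUnion fun _ =>
    measurableSet_intCast_eq i n).union ((measurableSet_isFreeHole k).inter (.const _))

theorem measurable_fillPoint (y : orbitClosure heaviside) : Measurable (fillPoint y) := by
  refine Measurable.subtype_mk (measurable_pi_iff.2 fun k => measurable_to_bool ?_)
  exact measurableSet_fill_eq_true y.1 k

/-- The law of the point over a Haar-random element of the adding machine whose remaining holes are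
filled by reading `y`: a continuous equivariant map from the orbit closure of the Heaviside sequence
to the space of measures. -/
noncomputable def fillLaw (y : orbitClosure heaviside) : ProbabilityMeasure (orbitClosure eta) :=
  ⟨haar.map (fillPoint y), Measure.isProbabilityMeasure_map (measurable_fillPoint y).aemeasurable⟩

theorem fillPoint_vadd (n : ℤ) (y : orbitClosure heaviside) (g : odometer) :
    fillPoint (n +ᵥ y) (g + intPoint n) = n +ᵥ fillPoint y g :=
  Subtype.ext (fill_shift y.1 g n)

/-- By invariance of the Haar measure, shifting the law only shifts the filling sequence. -/
theorem vadd_fillLaw (n : ℤ) (y : orbitClosure heaviside) :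
    n +ᵥ fillLaw y = fillLaw (n +ᵥ y) := by
  refine Subtype.ext ?_
  change (haar.map (fillPoint y)).map (fun x => n +ᵥ x) = haar.map (fillPoint (n +ᵥ y))
  rw [Measure.map_map (continuous_const_vadd n).measurable (measurable_fillPoint y)]
  conv_rhs => rw [← map_add_right_eq_self haar (intPoint n)]
  rw [Measure.map_map (measurable_fillPoint _) (measurable_add_const _)]
  congr 1
  funext g
  exact (fillPoint_vadd n y g).symm

theorem continuous_fillPoint (g : odometer) :
    Continuous fun y : orbitClosure heaviside => fillPoint y g := by
  refine Continuous.subtype_mk (continuous_pi fun k => ?_) _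
  by_cases h : IsFreeHole g.1 k
  · simp only [fill_of_isFreeHole h]
    exact (continuous_apply k).comp continuous_subtype_val
  · obtain ⟨i, n, hn, hh⟩ : ∃ (i : ℕ) (n : ℤ),
        (n : ZMod (period i)) = g.1 i ∧ ¬ IsHole i (n + k) := by
      simpa [IsFreeHole] using h
    simp only [codes_fill _ g i n hn k hh]
    fun_prop

/-- Dominated convergence: `fillPoint y g` depends continuously on `y` for each fixed `g`. -/
theorem continuous_fillLaw : Continuous fillLaw := by
  refine ProbabilityMeasure.continuous_iff_forall_continuous_integral.2 fun f => ?_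
  have : (fun y => ∫ x, f x ∂(fillLaw y : Measure (orbitClosure eta))) =
      fun y => ∫ g, f (fillPoint y g) ∂haar := by
    funext y
    exact integral_map (measurable_fillPoint y).aemeasurable
      f.continuous.stronglyMeasurable.aestronglyMeasurable
  rw [this]
  refine continuous_of_dominated (bound := fun _ => ‖f‖) (fun y => ?_)
    (fun y => Eventually.of_forall fun g => f.norm_coe_le_norm _) (integrable_const _)
    (Eventually.of_forall fun g => f.continuous.comp (continuous_fillPoint g))
  exact (f.continuous.measurable.comp (measurable_fillPoint y)).aestronglyMeasurable

/-- The constant sequences lie in the orbit closure of the Heaviside sequence. -/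
def constPoint (b : Bool) : orbitClosure heaviside :=
  ⟨fun _ => b, mem_orbitClosure_heaviside.2 monotone_const⟩

/-- The Heaviside sequence as a point of its orbit closure. -/
def heavisidePoint : orbitClosure heaviside :=
  ⟨heaviside, subset_closure ⟨0, SymbolicDynamics.FullShift.shift_zero _⟩⟩

theorem vadd_constPoint (n : ℤ) (b : Bool) : n +ᵥ constPoint b = constPoint b := rfl

theorem tendsto_vadd_heavisidePoint_atTop :
    Tendsto (fun n : ℤ => n +ᵥ heavisidePoint) atTop (𝓝 (constPoint true)) := by
  refine tendsto_subtype_rng.2 (tendsto_pi_nhds.2 fun k => tendsto_const_nhds.congr' ?_)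
  filter_upwards [eventually_ge_atTop (-k)] with n hn
  exact (decide_eq_true (by omega : 0 ≤ n + k)).symm

theorem tendsto_vadd_heavisidePoint_atBot :
    Tendsto (fun n : ℤ => n +ᵥ heavisidePoint) atBot (𝓝 (constPoint false)) := by
  refine tendsto_subtype_rng.2 (tendsto_pi_nhds.2 fun k => tendsto_const_nhds.congr' ?_)
  filter_upwards [eventually_lt_atBot (-k)] with n hn
  exact (decide_eq_false (by omega : ¬ 0 ≤ n + k)).symm

theorem denseRange_zsmul_intPoint_one : DenseRange fun n : ℤ => n • intPoint 1 := by
  intro g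
  choose n hn using exists_intCast_eq g
  refine mem_closure_of_tendsto (b := atTop) (f := fun j => n j • intPoint 1)
    (tendsto_subtype_rng.2 (tendsto_pi_nhds.2 fun i => tendsto_const_nhds.congr' ?_))
    (Eventually.of_forall fun j => ⟨n j, rfl⟩)
  filter_upwards [eventually_ge_atTop i] with j hj
  rw [← intCast_eq_of_le g hj (hn j)]
  simp [intPoint]

theorem ergodic_fillLaw_constPoint (b : Bool) :
    Ergodic (fun x : orbitClosure eta => (1 : ℤ) +ᵥ x)
      (fillLaw (constPoint b) : Measure (orbitClosure eta)) := by
  have h : Ergodic (intPoint 1 + ·) haar :=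
    ergodic_add_left_of_denseRange_zsmul denseRange_zsmul_intPoint_one haar
  refine MeasurePreserving.ergodic_of_ergodic_semiconj
    ((measurable_fillPoint (constPoint b)).measurePreserving haar) h
    (continuous_const_vadd (1 : ℤ)).measurable fun g => ?_
  have := fillPoint_vadd 1 (constPoint b) g
  rw [vadd_constPoint] at this
  rw [← this, add_comm]

/-! ### The holes have positive measure -/

theorem haar_real_intCast_eq (i : ℕ) (n : ℤ) :
    haar.real {g : odometer | (n : ZMod (period i)) = g.1 i} = (period i : ℝ)⁻¹ := by
  have hp : (0 : ℝ) < period i := by exact_mod_cast period_pos i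
  have htrans : ∀ n : ℤ, haar.real {g : odometer | (n : ZMod (period i)) = g.1 i} =
      haar.real {g : odometer | ((0 : ℤ) : ZMod (period i)) = g.1 i} := by
    intro n
    rw [measureReal_def, measureReal_def, ← measure_preimage_add_right haar (intPoint n)
      {g : odometer | (n : ZMod (period i)) = g.1 i}]
    congr 2
    ext g
    simp [intPoint, eq_comm]
  have hsum : haar.real (⋃ m ∈ Finset.Ico (0 : ℤ) (period i),
      {g : odometer | (m : ZMod (period i)) = g.1 i}) = ∑ m ∈ Finset.Ico (0 : ℤ) (period i),
      haar.real {g : odometer | (m : ZMod (period i)) = g.1 i} := by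
    refine measureReal_biUnion_finset ?_ fun m _ => measurableSet_intCast_eq i m
    intro m hm m' hm' hne
    rw [Finset.coe_Ico, Set.mem_Ico] at hm hm'
    refine Set.disjoint_left.2 fun g hg hg' => hne ?_
    have := (ZMod.intCast_eq_intCast_iff' m m' (period i)).1 (Eq.trans hg (Eq.symm hg'))
    rwa [Int.emod_eq_of_lt hm.1 hm.2, Int.emod_eq_of_lt hm'.1 hm'.2] at this
  have huniv : (⋃ m ∈ Finset.Ico (0 : ℤ) (period i),
      {g : odometer | (m : ZMod (period i)) = g.1 i}) = univ := by
    refine eq_univ_of_forall fun g => ?_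
    obtain ⟨m, hm⟩ := exists_intCast_eq g i
    refine mem_iUnion₂.2 ⟨m % period i, Finset.mem_Ico.2 ⟨Int.emod_nonneg _
      (period_int_pos i).ne', Int.emod_lt_of_pos _ (period_int_pos i)⟩, ?_⟩
    rw [Set.mem_ofPred_eq, ← hm]
    simp
  rw [huniv, probReal_univ, Finset.sum_congr rfl fun m _ => (htrans m).trans (htrans n).symm,
    Finset.sum_const, Int.card_Ico, sub_zero, Int.toNat_natCast, nsmul_eq_mul] at hsum
  exact eq_inv_of_mul_eq_one_right hsum.symm

/-- The elements of the adding machine with a hole of the `i`-th step at `0` form a decreasing sequence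
of sets of measure at least `1 / 2`. -/
theorem half_le_haar_isFreeHole :
    (1 / 2 : ℝ) ≤ haar.real {g : odometer | IsFreeHole g.1 0} := by
  classical
  let H : ℕ → Set odometer := fun i => ⋃ m ∈ (Finset.Ico (0 : ℤ) (period i)).filter (IsHole i),
    {g : odometer | (m : ZMod (period i)) = g.1 i}
  have hmem : ∀ i (g : odometer), g ∈ H i ↔
      ∀ n : ℤ, (n : ZMod (period i)) = g.1 i → IsHole i (n + 0) := by
    intro i g
    simp only [H, mem_iUnion₂, Finset.mem_filter, Finset.mem_Ico, Set.mem_ofPred_eq]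
    constructor
    · rintro ⟨m, ⟨-, hm⟩, hmg⟩ n hn
      exact isHole_of_le g le_rfl hn hmg (by simpa using hm)
    · intro h
      obtain ⟨m, hm⟩ := exists_intCast_eq g i
      have hm' : ((m % period i : ℤ) : ZMod (period i)) = g.1 i := by rw [← hm]; simp
      exact ⟨m % period i, ⟨⟨Int.emod_nonneg _ (period_int_pos i).ne',
        Int.emod_lt_of_pos _ (period_int_pos i)⟩, by simpa using h _ hm'⟩, hm'⟩
  have hmeas : ∀ i, MeasurableSet (H i) := fun i =>
    Finset.measurableSet_biUnion _ fun m _ => measurableSet_intCast_eq i m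
  have hreal : ∀ i, (1 / 2 : ℝ) ≤ haar.real (H i) := by
    intro i
    have : haar.real (H i) = holeCount i / period i := by
      rw [measureReal_biUnion_finset ?_ fun m _ => measurableSet_intCast_eq i m]
      · simp only [haar_real_intCast_eq, Finset.sum_const, nsmul_eq_mul, holeCount, div_eq_mul_inv]
      · intro m hm m' hm' hne
        rw [Finset.mem_coe, Finset.mem_filter, Finset.mem_Ico] at hm hm'
        refine Set.disjoint_left.2 fun g hg hg' => hne ?_
        have := (ZMod.intCast_eq_intCast_iff' m m' (period i)).1 (Eq.trans hg (Eq.symm hg'))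
        rwa [Int.emod_eq_of_lt hm.1.1 hm.1.2, Int.emod_eq_of_lt hm'.1.1 hm'.1.2] at this
    rw [this]
    exact half_le_holeCount_div i
  have hanti : Antitone H := by
    intro i j hij g hg
    rw [hmem] at hg ⊢
    intro n hn
    obtain ⟨m, hm⟩ := exists_intCast_eq g j
    exact isHole_of_le g hij hn hm (hg m hm)
  have hinter : {g : odometer | IsFreeHole g.1 0} = ⋂ i, H i := by
    ext g
    simp only [mem_iInter, hmem]
    rfl
  have hlim := tendsto_measure_iInter_atTop (μ := haar) (fun i => (hmeas i).nullMeasurableSet)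
    hanti ⟨0, measure_ne_top _ _⟩
  rw [hinter]
  exact ge_of_tendsto' ((ENNReal.tendsto_toReal (measure_ne_top _ _)).comp hlim) hreal

theorem fillLaw_constPoint_ne :
    fillLaw (constPoint false) ≠ fillLaw (constPoint true) := by
  intro h
  have hm : MeasurableSet {x : orbitClosure eta | x.1 0 = true} := by
    have : IsOpen ((fun x : orbitClosure eta => x.1 0) ⁻¹' {true}) :=
      (isOpen_discrete _).preimage ((continuous_apply 0).comp continuous_subtype_val)
    exact this.measurableSet
  have happ : ∀ b, (fillLaw (constPoint b) : Measure (orbitClosure eta))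
      {x : orbitClosure eta | x.1 0 = true} =
      haar {g : odometer | fill (fun _ => b) g.1 0 = true} := fun b =>
    Measure.map_apply (measurable_fillPoint _) hm
  have hU : {g : odometer | fill (fun _ => true) g.1 0 = true} =
      {g : odometer | fill (fun _ => false) g.1 0 = true} ∪
        {g : odometer | IsFreeHole g.1 0} := by
    ext g
    simp [fill_eq_true_iff]
  have hd : Disjoint {g : odometer | fill (fun _ => false) g.1 0 = true}
      {g : odometer | IsFreeHole g.1 0} := by
    refine Set.disjoint_left.2 fun g hg hh => ?_
    rw [Set.mem_ofPred_eq, fill_of_isFreeHole hh] at hg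
    exact Bool.false_ne_true hg
  have h1 := happ true
  rw [← h, happ false, hU, measure_union hd (measurableSet_isFreeHole 0)] at h1
  have h2 : haar {g : odometer | IsFreeHole g.1 0} = 0 := by
    have h3 := measure_ne_top haar {g : odometer | fill (fun _ => false) g.1 0 = true}
    nth_rewrite 1 [← add_zero (haar _)] at h1
    exact ((ENNReal.add_right_inj h3).1 h1).symm
  have h4 := half_le_haar_isFreeHole
  rw [measureReal_def, h2] at h4
  norm_num at h4

end Williams

theorem theoreme :
    ∃ (p : ℕ → ℕ) (η : ℤ → Bool),
      IsWilliamsOver (orbitClosure heaviside) p η ∧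
      IsToeplitz η ∧
      ¬ IsRegularToeplitz η ∧
      CompactSpace (orbitClosure η) ∧
      TopologicalSpace.MetrizableSpace (orbitClosure η) ∧
      AddAction.IsMinimal ℤ (orbitClosure η) ∧
      IsAlmostOneToOneExtension (orbitClosure η) p ∧
      (∃ ν μ₀ μ₁ : ProbabilityMeasure (orbitClosure η),
        Ergodic (fun x : orbitClosure η => (1 : ℤ) +ᵥ x) (μ₀ : Measure (orbitClosure η)) ∧
        Ergodic (fun x : orbitClosure η => (1 : ℤ) +ᵥ x) (μ₁ : Measure (orbitClosure η)) ∧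
        μ₀ ≠ μ₁ ∧
        Tendsto (fun n : ℤ => n +ᵥ ν) atBot (𝓝 μ₀) ∧
        Tendsto (fun n : ℤ => n +ᵥ ν) atTop (𝓝 μ₁) ∧
        IsProximal μ₀ ν ∧ IsProximal ν μ₁ ∧ ¬ IsProximal μ₀ μ₁) ∧
      ¬ Equivalence (IsProximal (Z := ProbabilityMeasure (orbitClosure η))) ∧
      ¬ IsInjectiveSystem (orbitClosure η) := by
  have hfix : ∀ b (n : ℤ), n +ᵥ Williams.fillLaw (Williams.constPoint b) =
      Williams.fillLaw (Williams.constPoint b) := fun b n => by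
    rw [Williams.vadd_fillLaw, Williams.vadd_constPoint]
  have hbot : Tendsto (fun n : ℤ => n +ᵥ Williams.fillLaw Williams.heavisidePoint) atBot
      (𝓝 (Williams.fillLaw (Williams.constPoint false))) := by
    simp only [Williams.vadd_fillLaw]
    exact (Williams.continuous_fillLaw.tendsto _).comp Williams.tendsto_vadd_heavisidePoint_atBot
  have htop : Tendsto (fun n : ℤ => n +ᵥ Williams.fillLaw Williams.heavisidePoint) atTop
      (𝓝 (Williams.fillLaw (Williams.constPoint true))) := by
    simp only [Williams.vadd_fillLaw]
    exact (Williams.continuous_fillLaw.tendsto _).comp Williams.tendsto_vadd_heavisidePoint_atTop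
  have hne := Williams.fillLaw_constPoint_ne
  have h₀ := Williams.isProximal_symm (Williams.isProximal_of_tendsto hbot (hfix false))
  have h₁ := Williams.isProximal_of_tendsto htop (hfix true)
  have h₀₁ := Williams.not_isProximal_of_fixed (hfix false) (hfix true) hne
  refine ⟨Williams.period, Williams.eta, Williams.isWilliamsOver_eta, Williams.isToeplitz_eta,
    Williams.not_isRegularToeplitz_eta, inferInstance, inferInstance,
    Williams.isMinimal_orbitClosure_eta, Williams.isAlmostOneToOneExtension_eta,
    ⟨_, _, _, Williams.ergodic_fillLaw_constPoint false, Williams.ergodic_fillLaw_constPoint true,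
      hne, hbot, htop, h₀, h₁, h₀₁⟩, fun h => h₀₁ (h.trans h₀ h₁), ?_⟩
  exact Williams.not_isInjectiveSystem Williams.continuous_toOdometer Williams.toOdometer_vadd
    (fun _ _ => Williams.isProximal_of_toOdometer_eq) hbot htop (hfix false) (hfix true) hne
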